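/- **Theorem 1.4.** Two players play for a stake of $1$. The game state is a Brownian motion run until it leaves $(0,1)$; reaching $1$ means victory for Player A (payoff $1$ to A) and reaching $0$ means victory for Player B (payoff $-1$ to A). The own state of A is the game state $p$, that of B is $1-p$. Players may propose a raise with an $(x,y)$-cube, where $0<x<y$ and $y>1$, at any state in $[0,1]$: the opponent either folds, which ends the game and pays the proposer $x$ times the current stake, or accepts, which multiplies the stake by $y$ and gives the opponent the sole right to make the next proposal. The first proposal may be made by either player. The number of proposals is limited. All players maximize their expected payoff: a proposal is answered by the better of folding and accepting, and the value of the remaining game is determined by backward induction over the number of proposals left, where a plan for the next proposal is a stopping time. For $k\ge 1$ let $$d_k=\frac{y(x+1)}{2y+xy-x}+\frac{x(1+x)(y-1)}{2(2y+xy-x)}\left(-\frac{y-x}{y(1+x)}\right)^k .$$ Suppose that $k\ge1$ proposals are left. 1. For the player holding the cube (the only one entitled to make the next proposal), $d_k$ is the unique optimal own state to raise: it is the only $d\in[0,1]$ such that, from every own state $p\le d$, raising on the first visit to $d$ has at least the expected payoff of every other plan. 2. If either player may make the next proposal, then $d_k>\tfrac12$ and raising at own state $d_k$ is optimal for both: from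 every $p\in[1-d_k,d_k]$, in particular from the initial state $\tfrac12$, if each player plans to raise on the first visit to own state $d_k$, then neither can gain by changing plan (whichever player's proposal counts when both propose at once). 3. Raising at $d_k$ is strictly preferable to not raising at all: for the player holding the cube, from every own state $p\in(0,d_k]$; and, when either player may make the next proposal and the opponent plans to raise at own state $d_k$, from every own state $p\in(1-d_k,d_k]$. -/

import Mathlib

open MeasureTheory ProbabilityTheory Set
open scoped NNReal

noncomputable section

namespace RaisingCube

/-- `B` is a standard one-dimensional Brownian motion relative to the filtration `𝓕`: it has the
finite-dimensional laws of Brownian motion, all its paths are continuous, it is adapted to `𝓕`, and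
its increments after time `s` are independent of `𝓕 s`. -/
structure IsBrownianMotion {Ω : Type*} [mΩ : MeasurableSpace Ω] (P : Measure Ω)
    (𝓕 : Filtration ℝ≥0 mΩ) (B : ℝ≥0 → Ω → ℝ) : Prop where
  law : IsPreBrownianReal B P
  continuous_paths : ∀ ω, Continuous fun t => B t ω
  adapted : ∀ t, Measurable[𝓕 t] (B t)
  indep_increments : ∀ s t, s ≤ t →
    Indep (MeasurableSpace.comap (fun ω => B t ω - B s ω) inferInstance) (𝓕 s) P

section Game

variable {Ω : Type*}

/-- Player A's game state when play (re)starts from state `p`. Only its values up to the time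
`endTime` are used, where it is in `[0, 1]`. Player B's game state is `1 - gameState B p t`. -/
def gameState (B : ℝ≥0 → Ω → ℝ) (p : ℝ) (t : ℝ≥0) (ω : Ω) : ℝ := p + B t ω

/-- The first time at which the game state leaves the open interval `(0, 1)`, that is, reaches
`0` (Player A loses) or `1` (Player A wins). -/
def endTime (B : ℝ≥0 → Ω → ℝ) (p : ℝ) : Ω → WithTop ℝ≥0 :=
  hittingAfter (gameState B p) (Ioo 0 1)ᶜ 0

/-- The plan "raise the first time that Player A's game state equals `d`". -/
def raiseAt (B : ℝ≥0 → Ω → ℝ) (p d : ℝ) : Ω → WithTop ℝ≥0 :=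
  hittingAfter (gameState B p) {d} 0

/-- The plan "never raise". -/
def neverRaise : Ω → WithTop ℝ≥0 := fun _ => ⊤

open Classical in
/-- Player A's payoff when the stake is `1`, play starts from state `p`, Player A plans to propose
at time `τ` and Player B at time `σ`. The first proposal counts, provided that it is made no later
than `endTime` (proposals at the extreme states `0` and `1` are allowed); if both players propose
at the same time, then `tieA` says whether it is Player A's proposal that counts. A proposal made
at the proposer's own state `q` is worth `g q` to the proposer. If nobody proposes, then the payoff
is `1` or `-1` according to whether state `1` or state `0` is reached. -/
def payoff (B : ℝ≥0 → Ω → ℝ) (g : ℝ → ℝ) (tieA : Bool) (p : ℝ) (τ σ : Ω → WithTop ℝ≥0)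
    (ω : Ω) : ℝ :=
  if τ ω ≠ ⊤ ∧ τ ω ≤ endTime B p ω ∧ (τ ω < σ ω ∨ (τ ω = σ ω ∧ tieA = true)) then
    g (stoppedValue (gameState B p) τ ω)
  else if σ ω ≠ ⊤ ∧ σ ω ≤ endTime B p ω then
    -g (1 - stoppedValue (gameState B p) σ ω)
  else if stoppedValue (gameState B p) (endTime B p) ω = 1 then 1 else -1

variable [mΩ : MeasurableSpace Ω]

/-- The value, for stake `1`, of the game to the player who holds the cube, that is, the only
player who is entitled to propose next, when `k` proposals are left and the holder's own game state
is `p`. With no proposals left it is the expected payoff of playing on to the end. With `k + 1`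
proposals left it is the supremum of the expected payoffs over all plans of the holder for the next
proposal (stopping times). When the holder proposes at own state `q`, the opponent, whose state is
`1 - q`, does whichever is better for the opponent: fold, which pays `x` to the holder, or accept,
after which the stake is `y` and the opponent holds the cube with `k` proposals left. -/
def holderValue (P : Measure Ω) (𝓕 : Filtration ℝ≥0 mΩ) (B : ℝ≥0 → Ω → ℝ) (x y : ℝ) :
    ℕ → ℝ → ℝ
  | 0, p => ∫ ω, payoff B (fun _ => 0) true p neverRaise neverRaise ω ∂P
  | k + 1, p => sSup {v | ∃ τ : Ω → WithTop ℝ≥0, IsStoppingTime 𝓕 τ ∧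
      v = ∫ ω, payoff B (fun q => min x (-(y * holderValue P 𝓕 B x y k (1 - q))))
        true p τ neverRaise ω ∂P}

/-- What a proposal, made at the proposer's own state `q` when `k ≥ 1` proposals (this one
included) are left, is worth to the proposer: the opponent picks the better of folding and
accepting. -/
def proposalValue (P : Measure Ω) (𝓕 : Filtration ℝ≥0 mΩ) (B : ℝ≥0 → Ω → ℝ) (x y : ℝ)
    (k : ℕ) (q : ℝ) : ℝ :=
  min x (-(y * holderValue P 𝓕 B x y (k - 1) (1 - q)))

/-- Player A's expected payoff with `k ≥ 1` proposals left and stake `1`, from state `p`, when the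
players plan their next proposals for the times `τ` (Player A) and `σ` (Player B). If only Player A
is entitled to make the next proposal, then `σ = neverRaise`. -/
def expectedPayoff (P : Measure Ω) (𝓕 : Filtration ℝ≥0 mΩ) (B : ℝ≥0 → Ω → ℝ) (x y : ℝ)
    (k : ℕ) (tieA : Bool) (p : ℝ) (τ σ : Ω → WithTop ℝ≥0) : ℝ :=
  ∫ ω, payoff B (proposalValue P 𝓕 B x y k) tieA p τ σ ω ∂P

/-- `d` is an optimal game state to raise for the player who holds the cube with `k` proposals
left: from every state that is not beyond `d`, raising on the first visit to `d` is at least as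
good as every other plan. -/
def IsOptimalRaisingState (P : Measure Ω) (𝓕 : Filtration ℝ≥0 mΩ) (B : ℝ≥0 → Ω → ℝ) (x y : ℝ)
    (k : ℕ) (d : ℝ) : Prop :=
  d ∈ Icc (0 : ℝ) 1 ∧ ∀ p ∈ Icc 0 d, ∀ τ : Ω → WithTop ℝ≥0, IsStoppingTime 𝓕 τ →
    expectedPayoff P 𝓕 B x y k true p τ neverRaise ≤
      expectedPayoff P 𝓕 B x y k true p (raiseAt B p d) neverRaise

/-- Raising at own state `d` is optimal play by both players when `k` proposals are left and either
player may make the next one (as at the start of the game): from every state at which neither is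
beyond own state `d`, if each player plans to raise at own state `d`, then neither can gain by
another plan. -/
def IsOpeningEquilibrium (P : Measure Ω) (𝓕 : Filtration ℝ≥0 mΩ) (B : ℝ≥0 → Ω → ℝ) (x y : ℝ)
    (k : ℕ) (tieA : Bool) (d : ℝ) : Prop :=
  ∀ p ∈ Icc (1 - d) d, ∀ ρ : Ω → WithTop ℝ≥0, IsStoppingTime 𝓕 ρ →
    expectedPayoff P 𝓕 B x y k tieA p ρ (raiseAt B p (1 - d)) ≤
      expectedPayoff P 𝓕 B x y k tieA p (raiseAt B p d) (raiseAt B p (1 - d)) ∧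
    expectedPayoff P 𝓕 B x y k tieA p (raiseAt B p d) (raiseAt B p (1 - d)) ≤
      expectedPayoff P 𝓕 B x y k tieA p (raiseAt B p d) ρ

end Game

/-- The closed form for the optimal state to raise with `k` proposals left. -/
def raisePoint (x y : ℝ) (k : ℕ) : ℝ :=
  y * (x + 1) / (2 * y + x * y - x) +
    x * (1 + x) * (y - 1) / (2 * (2 * y + x * y - x)) * (-((y - x) / (y * (1 + x)))) ^ k

end RaisingCube

end

/-! The game state is a bounded martingale up to the end of a stage, so its value `Z` at the first
proposal or at the end has mean `p` (`integral_stopState`). Hence a pathwise bound of the payoff by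
`a + b * Z` gives the bound `a + b * p` for its expectation, and optimality becomes a question of
lines lying above the value `G` of a proposal.

For the holder, the relevant line joins `(0, -1)` to `(d, x)`. It dominates `G` on `[0, 1]`, and
raising at `d` attains it from every state below `d`. Raising elsewhere fails: `G` is strictly below
the line before `d`, and equal to the stake factor `x` after `d`, where waiting brings no gain. When
both may propose, the line joins `(1 - d, -x)` to `(d, x)`; it is odd under exchange of the players,
so one inequality handles the deviations of both. Since `2 * d < 1 + x`, these lines are steeper
than the payoff lines without raising, which gives strictness.

The conditions on `G` are collected in `IsRaiseReward` and proved in `isRaiseReward`. If the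
accepting opponent will raise at `c`, then `d` is the state where folding and accepting cost the
same: `y * (-1 + (1 + x) / c * (1 - d)) = -x`. This is the recursion `raisePoint_succ`. It starts
from `(1 + x) / 2`, for which the holder's formula reduces to the value `2 * p - 1` of the game
without proposals; `holderValue_eq` is then an induction. -/

noncomputable section

namespace RaisingCube

open Filter Topology

/-! ### Hitting times of closed sets by continuous processes -/

section HittingTimes

variable {Ω : Type*} {u : ℝ≥0 → Ω → ℝ} {C : Set ℝ} {ω : Ω}

lemma exists_hittingAfter_eq_coe (hu : Continuous fun t => u t ω) (hC : IsClosed C)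
    (h : hittingAfter u C 0 ω ≠ ⊤) :
    ∃ t : ℝ≥0, hittingAfter u C 0 ω = t ∧ u t ω ∈ C := by
  classical
  have hex : ∃ j, 0 ≤ j ∧ u j ω ∈ C := by
    by_contra hne
    push Not at hne
    exact h (hittingAfter_eq_top_iff.2 hne)
  refine ⟨sInf {i : ℝ≥0 | 0 ≤ i ∧ u i ω ∈ C}, by simp only [hittingAfter, if_pos hex], ?_⟩
  have hcl : IsClosed {i : ℝ≥0 | 0 ≤ i ∧ u i ω ∈ C} :=
    (isClosed_le continuous_const continuous_id).inter (hC.preimage hu)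
  exact (hcl.csInf_mem hex (OrderBot.bddBelow _)).2

lemma hittingAfter_zero_le_iff (hu : Continuous fun t => u t ω) (hC : IsClosed C) {t : ℝ≥0} :
    hittingAfter u C 0 ω ≤ t ↔ ∃ s ≤ t, u s ω ∈ C := by
  constructor
  · intro h
    have hne : hittingAfter u C 0 ω ≠ ⊤ := fun h' => by
      rw [h'] at h
      exact (WithTop.coe_lt_top _).not_ge h
    obtain ⟨s, hs, hsC⟩ := exists_hittingAfter_eq_coe hu hC hne
    rw [hs] at h
    exact ⟨s, by exact_mod_cast h, hsC⟩
  · rintro ⟨s, hs, hsC⟩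
    exact (hittingAfter_le_of_mem zero_le hsC).trans (by exact_mod_cast hs)

/-- The first hitting time of a closed set by a continuous adapted real process is a stopping
time. -/
lemma isStoppingTime_hittingAfter_of_isClosed [mΩ : MeasurableSpace Ω] {𝓕 : Filtration ℝ≥0 mΩ}
    (hadapt : ∀ t, Measurable[𝓕 t] (u t)) (hu : ∀ ω, Continuous fun t => u t ω)
    (hC : IsClosed C) (hne : C.Nonempty) : IsStoppingTime 𝓕 (hittingAfter u C 0) := by
  intro t
  -- The set is hit by time `t` iff the distance to it has infimum `0` over the compact interval up
  -- to `t`; by continuity a countable dense set of times detects this.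
  have key : {ω | hittingAfter u C 0 ω ≤ t} = ⋂ n : ℕ, ⋃ m : ℕ,
      {ω | Metric.infDist (u (TopologicalSpace.denseSeq (Iic t) m) ω) C < 1 / ((n : ℝ) + 1)} := by
    ext ω
    have hcont : Continuous fun s : Iic t => Metric.infDist (u s ω) C :=
      (Metric.continuous_infDist_pt C).comp ((hu ω).comp continuous_subtype_val)
    simp only [mem_ofPred_eq, hittingAfter_zero_le_iff (hu ω) hC, mem_iInter, mem_iUnion]
    constructor
    · rintro ⟨s, hs, hsC⟩ n
      have hopen : IsOpen {r : Iic t | Metric.infDist (u r ω) C < 1 / ((n : ℝ) + 1)} :=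
        isOpen_lt hcont continuous_const
      obtain ⟨m, hm⟩ := (TopologicalSpace.denseRange_denseSeq (Iic t)).exists_mem_open hopen
        ⟨⟨s, hs⟩, by
          simp only [mem_ofPred_eq, Metric.infDist_zero_of_mem hsC]
          positivity⟩
      exact ⟨m, hm⟩
    · intro h
      have hcompact : IsCompact (Iic t : Set ℝ≥0) := by
        rw [← Icc_bot]
        exact isCompact_Icc
      obtain ⟨s, hs, hmin⟩ := hcompact.exists_isMinOn ⟨t, le_refl t⟩
        ((Metric.continuous_infDist_pt C).comp (hu ω)).continuousOn
      refine ⟨s, hs, (hC.mem_iff_infDist_zero hne).2 (le_antisymm ?_ Metric.infDist_nonneg)⟩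
      refine ge_of_tendsto' tendsto_one_div_add_atTop_nhds_zero_nat fun n => ?_
      obtain ⟨m, hm⟩ := h n
      exact (hmin (TopologicalSpace.denseSeq (Iic t) m).2).trans hm.le
  rw [key]
  refine MeasurableSet.iInter fun n => MeasurableSet.iUnion fun m => ?_
  have hm : Measurable[𝓕 t] (u (TopologicalSpace.denseSeq (Iic t) m)) :=
    (hadapt _).mono (𝓕.mono (TopologicalSpace.denseSeq (Iic t) m).2) le_rfl
  exact measurableSet_lt ((Metric.continuous_infDist_pt C).measurable.comp hm) measurable_const

end HittingTimes

lemma untopA_coe_eq_self (t : ℝ≥0) : (t : WithTop ℝ≥0).untopA = t := rfl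

/-! ### Approximation of stopping times from above -/

section Discretization

variable {Ω : Type*} {θ : Ω → WithTop ℝ≥0}

/-- The approximation of a finite time from above by a multiple of `1 / (n + 1)`. -/
def ceilTime (θ : Ω → WithTop ℝ≥0) (n : ℕ) (ω : Ω) : ℝ≥0 :=
  (⌈((n : ℝ≥0) + 1) * (θ ω).untopA⌉₊ : ℝ≥0) / ((n : ℝ≥0) + 1)

lemma untopA_le_ceilTime (n : ℕ) (ω : Ω) : (θ ω).untopA ≤ ceilTime θ n ω := by
  rw [ceilTime, le_div_iff₀ (by positivity), mul_comm]
  exact Nat.le_ceil _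

lemma ceilTime_le (n : ℕ) (ω : Ω) :
    ceilTime θ n ω ≤ (θ ω).untopA + 1 / ((n : ℝ≥0) + 1) := by
  have hpos : (n : ℝ≥0) + 1 ≠ 0 := by positivity
  rw [ceilTime, div_le_iff₀ (by positivity)]
  refine (Nat.ceil_lt_add_one zero_le).le.trans_eq ?_
  field_simp

lemma tendsto_ceilTime (ω : Ω) :
    Tendsto (fun n => ceilTime θ n ω) atTop (𝓝 (θ ω).untopA) := by
  refine tendsto_of_tendsto_of_tendsto_of_le_of_le tendsto_const_nhds ?_
    (fun n => untopA_le_ceilTime n ω) (fun n => ceilTime_le n ω)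
  have h : Tendsto (fun n : ℕ => 1 / ((n : ℝ≥0) + 1)) atTop (𝓝 0) := by
    rw [← NNReal.tendsto_coe]
    simpa using tendsto_one_div_add_atTop_nhds_zero_nat (𝕜 := ℝ)
  simpa using tendsto_const_nhds.add h

lemma countable_range_ceilTime (n : ℕ) :
    (range fun ω => (ceilTime θ n ω : WithTop ℝ≥0)).Countable := by
  refine (countable_range fun k : ℕ =>
    (((k : ℝ≥0) / ((n : ℝ≥0) + 1) : ℝ≥0) : WithTop ℝ≥0)).mono ?_
  rintro _ ⟨ω, rfl⟩
  exact ⟨_, rfl⟩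

lemma isStoppingTime_ceilTime [mΩ : MeasurableSpace Ω] {𝓕 : Filtration ℝ≥0 mΩ}
    (hθ : IsStoppingTime 𝓕 θ) (hfin : ∀ ω, θ ω ≠ ⊤) (n : ℕ) :
    IsStoppingTime 𝓕 fun ω => (ceilTime θ n ω : WithTop ℝ≥0) := by
  intro i
  have hpos : (0 : ℝ≥0) < (n : ℝ≥0) + 1 := by positivity
  -- `j` is the last grid point up to `i`: rounding up stays below `i` exactly when the time itself
  -- is at most `j`.
  set j : ℝ≥0 := (⌊i * ((n : ℝ≥0) + 1)⌋₊ : ℝ≥0) / ((n : ℝ≥0) + 1) with hj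
  have hji : j ≤ i := by
    rw [hj, div_le_iff₀ hpos]
    exact Nat.floor_le zero_le
  have key : {ω | (ceilTime θ n ω : WithTop ℝ≥0) ≤ i} = {ω | θ ω ≤ j} := by
    ext ω
    obtain ⟨t, ht⟩ := WithTop.ne_top_iff_exists.1 (hfin ω)
    simp only [mem_ofPred_eq, ceilTime, ← ht, WithTop.coe_le_coe, untopA_coe_eq_self]
    rw [div_le_iff₀ hpos, ← Nat.le_floor_iff zero_le, hj, le_div_iff₀ hpos, Nat.ceil_le, mul_comm]
  rw [key]
  exact 𝓕.mono hji _ (hθ j)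

end Discretization

/-! ### Martingale property, optional stopping and exit from the unit interval -/

namespace IsBrownianMotion

variable {Ω : Type*} [mΩ : MeasurableSpace Ω] {P : Measure Ω}
  {𝓕 : Filtration ℝ≥0 mΩ} {B : ℝ≥0 → Ω → ℝ}

lemma stronglyAdapted (hB : IsBrownianMotion P 𝓕 B) : StronglyAdapted 𝓕 B :=
  fun t => (hB.adapted t).stronglyMeasurable

lemma isStronglyProgressive (hB : IsBrownianMotion P 𝓕 B) : IsStronglyProgressive 𝓕 B :=
  hB.stronglyAdapted.isStronglyProgressive_of_continuous hB.continuous_paths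

lemma martingale [IsProbabilityMeasure P] (hB : IsBrownianMotion P 𝓕 B) : Martingale B 𝓕 P := by
  refine ⟨hB.stronglyAdapted, fun s t hst => ?_⟩
  have hint := hB.law.integrable_eval
  have hmeas : Measurable fun ω => B t ω - B s ω :=
    ((hB.adapted t).mono (𝓕.le t) le_rfl).sub ((hB.adapted s).mono (𝓕.le s) le_rfl)
  have h1 : P[fun ω => B t ω - B s ω | 𝓕 s] =ᵐ[P] fun _ => ∫ ω, (B t ω - B s ω) ∂P :=
    condExp_indep_eq hmeas.comap_le (𝓕.le s)
      (comap_measurable _).stronglyMeasurable (hB.indep_increments s t hst)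
  have h2 : ∫ ω, (B t ω - B s ω) ∂P = 0 := by
    rw [integral_sub (hint t) (hint s), hB.law.integral_eval, hB.law.integral_eval, sub_zero]
  have h3 : P[B s | 𝓕 s] = B s :=
    condExp_of_stronglyMeasurable (𝓕.le s) (hB.stronglyAdapted s) (hint s)
  have h4 := condExp_add ((hint t).sub (hint s)) (hint s) (𝓕 s)
  have h5 : B t - B s + B s = B t := sub_add_cancel _ _
  rw [h5, h3] at h4
  filter_upwards [h1, h4] with ω hω1 hω4
  rw [hω4, Pi.add_apply]
  have : (P[B t - B s | 𝓕 s]) ω = 0 := by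
    rw [← h2]
    exact hω1
  rw [this, zero_add]

/-- Optional stopping for Brownian motion at a bounded stopping time, up to which it is bounded. -/
lemma integral_stoppedValue_of_le [IsProbabilityMeasure P] (hB : IsBrownianMotion P 𝓕 B)
    {θ : Ω → WithTop ℝ≥0}
    (hθ : IsStoppingTime 𝓕 θ) {N : ℝ≥0} (hN : ∀ ω, θ ω ≤ N) {c : ℝ}
    (hc : ∀ᵐ ω ∂P, ‖stoppedValue B θ ω‖ ≤ c) : ∫ ω, stoppedValue B θ ω ∂P = 0 := by
  have hfin : ∀ ω, θ ω ≠ ⊤ := fun ω h =>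
    (WithTop.coe_lt_top N).not_ge (h ▸ hN ω)
  have hst := isStoppingTime_ceilTime hθ hfin
  -- Rounding up costs at most `1 / (n + 1) ≤ 1`, so the horizon `N + 1` serves all approximations.
  have hle : ∀ n ω, (ceilTime θ n ω : WithTop ℝ≥0) ≤ (N + 1 : ℝ≥0) := by
    intro n ω
    obtain ⟨t, ht⟩ := WithTop.ne_top_iff_exists.1 (hfin ω)
    have htN := hN ω
    rw [← ht, WithTop.coe_le_coe] at htN
    rw [WithTop.coe_le_coe]
    refine (ceilTime_le n ω).trans ?_
    rw [← ht, untopA_coe_eq_self]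
    refine add_le_add htN ?_
    rw [div_le_one (by positivity)]
    exact le_add_of_nonneg_left zero_le
  have hcond : ∀ n, stoppedValue B (fun ω => (ceilTime θ n ω : WithTop ℝ≥0)) =ᵐ[P]
      P[B (N + 1) | (hst n).measurableSpace] := fun n =>
    hB.martingale.stoppedValue_ae_eq_condExp_of_le_const_of_countable_range (hst n) (hle n)
      (countable_range_ceilTime n)
  have hint := hB.law.integrable_eval (N + 1)
  have hmeas : Measurable (stoppedValue B θ) :=
    (measurable_stoppedValue hB.isStronglyProgressive hθ).mono hθ.measurableSpace_le le_rfl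
  -- Conditional expectations of one integrable variable are uniformly integrable, so by Vitali's
  -- theorem pointwise convergence along the path becomes convergence in `L¹`.
  have hui := (hint.uniformIntegrable_condExp fun n => (hst n).measurableSpace_le).ae_eq
    fun n => (hcond n).symm
  have hlim := tendsto_Lp_finite_of_tendsto_ae (g := stoppedValue B θ) le_rfl ENNReal.one_ne_top
    (fun n => (hui.1 n)) (MemLp.of_bound hmeas.aestronglyMeasurable c hc) hui.2.1 (by
      refine Eventually.of_forall fun ω => ?_
      exact ((hB.continuous_paths ω).tendsto _).comp (tendsto_ceilTime ω))
  have hlim2 := tendsto_integral_of_L1' _ hmeas.aestronglyMeasurable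
    (Eventually.of_forall fun n => integrable_condExp.congr (hcond n).symm) hlim
  refine tendsto_nhds_unique hlim2 ?_
  refine tendsto_const_nhds.congr fun n => ?_
  rw [integral_congr_ae (hcond n), integral_condExp (hst n).measurableSpace_le,
    hB.law.integral_eval]

section ExitTime

lemma continuous_gameState (hB : IsBrownianMotion P 𝓕 B) (p : ℝ) (ω : Ω) :
    Continuous fun t => gameState B p t ω :=
  continuous_const.add (hB.continuous_paths ω)

lemma isStoppingTime_hit (hB : IsBrownianMotion P 𝓕 B) (p : ℝ) {C : Set ℝ} (hC : IsClosed C)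
    (hne : C.Nonempty) : IsStoppingTime 𝓕 (hittingAfter (gameState B p) C 0) :=
  isStoppingTime_hittingAfter_of_isClosed (fun t => measurable_const.add (hB.adapted t))
    (hB.continuous_gameState p) hC hne

lemma isStoppingTime_endTime (hB : IsBrownianMotion P 𝓕 B) (p : ℝ) :
    IsStoppingTime 𝓕 (endTime B p) :=
  hB.isStoppingTime_hit p isOpen_Ioo.isClosed_compl ⟨0, by simp⟩

lemma isStoppingTime_raiseAt (hB : IsBrownianMotion P 𝓕 B) (p d : ℝ) :
    IsStoppingTime 𝓕 (raiseAt B p d) :=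
  hB.isStoppingTime_hit p isClosed_singleton ⟨d, rfl⟩

lemma isStronglyProgressive_gameState (hB : IsBrownianMotion P 𝓕 B) (p : ℝ) :
    IsStronglyProgressive 𝓕 (gameState B p) :=
  StronglyAdapted.isStronglyProgressive_of_continuous
    (fun t => (measurable_const.add (hB.adapted t)).stronglyMeasurable) (hB.continuous_gameState p)

lemma measurable_stoppedValue_gameState (hB : IsBrownianMotion P 𝓕 B) (p : ℝ)
    {θ : Ω → WithTop ℝ≥0} (hθ : IsStoppingTime 𝓕 θ) :
    Measurable (stoppedValue (gameState B p) θ) :=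
  (measurable_stoppedValue (hB.isStronglyProgressive_gameState p) hθ).mono
    hθ.measurableSpace_le le_rfl

/-- Brownian motion leaves the unit interval in finite time. -/
lemma endTime_ne_top (hB : IsBrownianMotion P 𝓕 B) (p : ℝ) :
    ∀ᵐ ω ∂P, endTime B p ω ≠ ⊤ := by
  have hbound : ∀ n : ℕ, P {ω | endTime B p ω = ⊤} ≤
      ENNReal.ofReal ((√(n + 1 : ℝ))⁻¹) := by
    intro n
    set v : ℝ≥0 := (n : ℝ≥0) + 1 with hv
    have hv0 : v ≠ 0 := by positivity
    have hvr : (v : ℝ) = n + 1 := by simp [hv]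
    -- A path that never exits lies at time `v` in an interval of length `1`, whose probability is
    -- at most the maximal Gaussian density, of order `1 / √v`.
    have hsub : {ω | endTime B p ω = ⊤} ⊆ B v ⁻¹' Ioo (-p) (1 - p) := by
      intro ω hω
      have := (hittingAfter_eq_top_iff.1 hω) v zero_le
      simp only [mem_compl_iff, not_not, gameState, mem_Ioo] at this
      exact ⟨by linarith [this.1], by linarith [this.2]⟩
    refine (measure_mono hsub).trans ?_
    have hlaw := hB.law.hasLaw_eval v
    rw [← Measure.map_apply_of_aemeasurable hlaw.aemeasurable measurableSet_Ioo, hlaw.map_eq,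
      gaussianReal_apply _ hv0]
    have hpdf : ∀ z, gaussianPDF 0 v z ≤ ENNReal.ofReal ((√(n + 1 : ℝ))⁻¹) := by
      intro z
      refine ENNReal.ofReal_le_ofReal ?_
      rw [gaussianPDFReal, hvr]
      have h1 : Real.exp (-(z - 0) ^ 2 / (2 * ((n : ℝ) + 1))) ≤ 1 := by
        rw [Real.exp_le_one_iff, neg_div]
        exact neg_nonpos.2 (by positivity)
      have h2 : (√(2 * Real.pi * ((n : ℝ) + 1)))⁻¹ ≤ (√(n + 1 : ℝ))⁻¹ := by
        refine inv_anti₀ (by positivity) (Real.sqrt_le_sqrt ?_)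
        nlinarith [Real.pi_gt_three, (Nat.cast_nonneg n : (0 : ℝ) ≤ n)]
      calc _ ≤ (√(2 * Real.pi * ((n : ℝ) + 1)))⁻¹ * 1 := by gcongr
        _ ≤ _ := by rwa [mul_one]
    calc ∫⁻ z in Ioo (-p) (1 - p), gaussianPDF 0 v z
        ≤ ∫⁻ _ in Ioo (-p) (1 - p), ENNReal.ofReal ((√(n + 1 : ℝ))⁻¹) :=
          lintegral_mono hpdf
      _ = ENNReal.ofReal ((√(n + 1 : ℝ))⁻¹) := by simp
  have hlim : Tendsto (fun n : ℕ => ENNReal.ofReal ((√(n + 1 : ℝ))⁻¹)) atTop (𝓝 0) := by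
    rw [← ENNReal.ofReal_zero]
    refine ENNReal.tendsto_ofReal (tendsto_inv_atTop_zero.comp (Real.tendsto_sqrt_atTop.comp ?_))
    exact tendsto_atTop_add_const_right _ _ tendsto_natCast_atTop_atTop
  rw [ae_iff]
  simp only [not_not]
  exact le_antisymm (ge_of_tendsto' hlim hbound) zero_le

end ExitTime

end IsBrownianMotion

/-! ### Pathwise description of a stage of the game -/

section Paths

variable {Ω : Type*} {B : ℝ≥0 → Ω → ℝ} {p c : ℝ} {ω : Ω} {t : ℝ≥0}

lemma gameState_zero (h0 : B 0 ω = 0) : gameState B p 0 ω = p := by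
  simp [gameState, h0]

lemma exists_le_gameState_eq (hc : Continuous fun t => gameState B p t ω) (h0 : B 0 ω = 0)
    (h : c ∈ uIcc p (gameState B p t ω)) : ∃ s ≤ t, gameState B p s ω = c := by
  have hivt := intermediate_value_uIcc (a := (0 : ℝ≥0)) (b := t) hc.continuousOn
  simp only [gameState_zero h0] at hivt
  obtain ⟨s, hs, hsc⟩ := hivt h
  rw [uIcc_of_le zero_le] at hs
  exact ⟨s, hs.2, hsc⟩

/-- A continuous path cannot jump over `0` or `1`: being outside at time `t` would force an earlier
visit to an endpoint, hence an earlier end. -/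
lemma gameState_mem_Icc (hc : Continuous fun t => gameState B p t ω) (h0 : B 0 ω = 0)
    (hp : p ∈ Icc (0 : ℝ) 1) (ht : (t : WithTop ℝ≥0) ≤ endTime B p ω) :
    gameState B p t ω ∈ Icc (0 : ℝ) 1 := by
  have hend : ∀ s < t, gameState B p s ω ∈ Ioo (0 : ℝ) 1 := fun s hs =>
    not_not.1 (notMem_of_lt_hittingAfter
      ((WithTop.coe_lt_coe.2 hs).trans_le ht : (s : WithTop ℝ≥0) < endTime B p ω) zero_le)
  by_contra hout
  rw [mem_Icc, not_and_or, not_le, not_le] at hout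
  rcases hout with hlt | hgt
  · obtain ⟨s, hs, hs0⟩ := exists_le_gameState_eq hc h0 (mem_uIcc.2 (Or.inr ⟨hlt.le, hp.1⟩))
    rcases hs.lt_or_eq with hs | rfl
    · exact (hend s hs).1.ne' hs0
    · exact hlt.ne hs0
  · obtain ⟨s, hs, hs1⟩ := exists_le_gameState_eq hc h0 (mem_uIcc.2 (Or.inl ⟨hp.2, hgt.le⟩))
    rcases hs.lt_or_eq with hs | rfl
    · exact (hend s hs).2.ne hs1
    · exact hgt.ne' hs1

lemma gameState_endTime (hc : Continuous fun t => gameState B p t ω) (h0 : B 0 ω = 0)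
    (hp : p ∈ Icc (0 : ℝ) 1) (ht : endTime B p ω = t) :
    gameState B p t ω = 0 ∨ gameState B p t ω = 1 := by
  obtain ⟨s, hs, hsC⟩ := exists_hittingAfter_eq_coe hc isOpen_Ioo.isClosed_compl
    (show endTime B p ω ≠ ⊤ from ht ▸ WithTop.coe_ne_top)
  obtain rfl : t = s := WithTop.coe_injective (ht.symm.trans hs)
  have hmem := gameState_mem_Icc hc h0 hp ht.ge
  rw [mem_compl_iff, mem_Ioo, not_and_or, not_lt, not_lt] at hsC
  exact hsC.imp (fun h => le_antisymm h hmem.1) fun h => le_antisymm hmem.2 h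

lemma gameState_raiseAt (hc : Continuous fun t => gameState B p t ω) (ht : raiseAt B p c ω = t) :
    gameState B p t ω = c := by
  obtain ⟨s, hs, hsC⟩ := exists_hittingAfter_eq_coe hc isClosed_singleton
    (show raiseAt B p c ω ≠ ⊤ from ht ▸ WithTop.coe_ne_top)
  obtain rfl : t = s := WithTop.coe_injective (ht.symm.trans hs)
  exact hsC

lemma raiseAt_le (hc : Continuous fun t => gameState B p t ω) (h0 : B 0 ω = 0)
    (h : c ∈ uIcc p (gameState B p t ω)) : raiseAt B p c ω ≤ t := by
  obtain ⟨s, hs, hsc⟩ := exists_le_gameState_eq hc h0 h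
  exact (hittingAfter_zero_le_iff hc isClosed_singleton).2 ⟨s, hs, hsc⟩

lemma gameState_le_of_le_raiseAt (hc : Continuous fun t => gameState B p t ω) (h0 : B 0 ω = 0)
    (hpc : p ≤ c) (ht : (t : WithTop ℝ≥0) ≤ raiseAt B p c ω) : gameState B p t ω ≤ c := by
  by_contra! hlt
  have hle := raiseAt_le hc h0 (mem_uIcc.2 (Or.inl ⟨hpc, hlt.le⟩))
  exact hlt.ne' (gameState_raiseAt hc (le_antisymm hle ht))

lemma le_gameState_of_le_raiseAt (hc : Continuous fun t => gameState B p t ω) (h0 : B 0 ω = 0)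
    (hpc : c ≤ p) (ht : (t : WithTop ℝ≥0) ≤ raiseAt B p c ω) : c ≤ gameState B p t ω := by
  by_contra! hlt
  have hle := raiseAt_le hc h0 (mem_uIcc.2 (Or.inr ⟨hlt.le, hpc⟩))
  exact hlt.ne (gameState_raiseAt hc (le_antisymm hle ht))

/-- The time at which the first proposal is made or the game ends without one. -/
def stopTime (B : ℝ≥0 → Ω → ℝ) (p : ℝ) (τ σ : Ω → WithTop ℝ≥0) (ω : Ω) : WithTop ℝ≥0 :=
  min (min (τ ω) (σ ω)) (endTime B p ω)

/-- The game state at which the first proposal is made or the game ends without one. -/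
def stopState (B : ℝ≥0 → Ω → ℝ) (p : ℝ) (τ σ : Ω → WithTop ℝ≥0) : Ω → ℝ :=
  stoppedValue (gameState B p) (stopTime B p τ σ)

lemma stopState_eq {τ σ : Ω → WithTop ℝ≥0} (h : stopTime B p τ σ ω = t) :
    stopState B p τ σ ω = gameState B p t ω := by
  rw [stopState, stoppedValue, h, untopA_coe_eq_self]

/-- How the current stage of the game may end: Player A's proposal, Player B's proposal, or one of
the extreme states. -/
lemma payoff_cases {g : ℝ → ℝ} {tieA : Bool} {τ σ : Ω → WithTop ℝ≥0}
    (hc : Continuous fun t => gameState B p t ω) (h0 : B 0 ω = 0) (hend : endTime B p ω ≠ ⊤)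
    (hp : p ∈ Icc (0 : ℝ) 1) :
    ∃ t : ℝ≥0, (t : WithTop ℝ≥0) ≤ endTime B p ω ∧ stopState B p τ σ ω = gameState B p t ω ∧
      gameState B p t ω ∈ Icc (0 : ℝ) 1 ∧
      ((τ ω = t ∧ t ≤ σ ω ∧ payoff B g tieA p τ σ ω = g (gameState B p t ω)) ∨
        (σ ω = t ∧ t ≤ τ ω ∧ payoff B g tieA p τ σ ω = -g (1 - gameState B p t ω)) ∨
        (endTime B p ω = t ∧ t < τ ω ∧ t < σ ω ∧
          ((gameState B p t ω = 1 ∧ payoff B g tieA p τ σ ω = 1) ∨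
            (gameState B p t ω = 0 ∧ payoff B g tieA p τ σ ω = -1)))) := by
  by_cases hA : τ ω ≠ ⊤ ∧ τ ω ≤ endTime B p ω ∧ (τ ω < σ ω ∨ (τ ω = σ ω ∧ tieA = true))
  · obtain ⟨t, ht⟩ := WithTop.ne_top_iff_exists.1 hA.1
    have hle : (t : WithTop ℝ≥0) ≤ σ ω := by
      rw [ht]
      exact hA.2.2.elim le_of_lt fun h => h.1.le
    have htE : (t : WithTop ℝ≥0) ≤ endTime B p ω := ht ▸ hA.2.1
    refine ⟨t, htE, stopState_eq ?_, gameState_mem_Icc hc h0 hp htE, Or.inl ⟨ht.symm, hle, ?_⟩⟩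
    · rw [stopTime, ← ht, min_eq_left hle, min_eq_left htE]
    · rw [payoff, if_pos hA, stoppedValue, ← ht, untopA_coe_eq_self]
  by_cases hS : σ ω ≠ ⊤ ∧ σ ω ≤ endTime B p ω
  · obtain ⟨t, ht⟩ := WithTop.ne_top_iff_exists.1 hS.1
    have htE : (t : WithTop ℝ≥0) ≤ endTime B p ω := ht ▸ hS.2
    have hle : (t : WithTop ℝ≥0) ≤ τ ω := by
      by_contra! hlt
      exact hA ⟨hlt.ne_top, hlt.le.trans htE, Or.inl (hlt.trans_eq ht)⟩
    refine ⟨t, htE, stopState_eq ?_, gameState_mem_Icc hc h0 hp htE,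
      Or.inr (Or.inl ⟨ht.symm, hle, ?_⟩)⟩
    · rw [stopTime, ← ht, min_eq_right hle, min_eq_left htE]
    · rw [payoff, if_neg hA, if_pos hS, stoppedValue, ← ht, untopA_coe_eq_self]
  · obtain ⟨t, ht⟩ := WithTop.ne_top_iff_exists.1 hend
    have hS' : (t : WithTop ℝ≥0) < σ ω := by
      by_contra! hle
      exact hS ⟨ne_top_of_le_ne_top WithTop.coe_ne_top hle, hle.trans_eq ht⟩
    have hA' : (t : WithTop ℝ≥0) < τ ω := by
      by_contra! hle
      exact hA ⟨ne_top_of_le_ne_top WithTop.coe_ne_top hle, hle.trans_eq ht,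
        Or.inl (hle.trans_lt hS')⟩
    refine ⟨t, ht.le, stopState_eq ?_, gameState_mem_Icc hc h0 hp ht.le,
      Or.inr (Or.inr ⟨ht.symm, hA', hS', ?_⟩)⟩
    · rw [stopTime, ← ht, min_eq_right (le_min hA'.le hS'.le)]
    · rw [payoff, if_neg hA, if_neg hS, stoppedValue, ← ht, untopA_coe_eq_self]
      rcases gameState_endTime hc h0 hp ht.symm with h | h
      · exact Or.inr ⟨h, by simp [h]⟩
      · exact Or.inl ⟨h, by simp [h]⟩

lemma payoff_congr {g G : ℝ → ℝ} {tieA : Bool} {τ σ : Ω → WithTop ℝ≥0}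
    (hc : Continuous fun t => gameState B p t ω) (h0 : B 0 ω = 0) (hp : p ∈ Icc (0 : ℝ) 1)
    (hgG : ∀ q ∈ Icc (0 : ℝ) 1, g q = G q) :
    payoff B g tieA p τ σ ω = payoff B G tieA p τ σ ω := by
  have hmem : ∀ θ : Ω → WithTop ℝ≥0, θ ω ≠ ⊤ → θ ω ≤ endTime B p ω →
      stoppedValue (gameState B p) θ ω ∈ Icc (0 : ℝ) 1 := by
    intro θ hθ hle
    obtain ⟨t, ht⟩ := WithTop.ne_top_iff_exists.1 hθ
    rw [stoppedValue, ← ht, untopA_coe_eq_self]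
    exact gameState_mem_Icc hc h0 hp (ht ▸ hle)
  unfold payoff
  split_ifs with h1 h2
  · exact hgG _ (hmem τ h1.1 h1.2.1)
  · have := hmem σ h2.1 h2.2
    rw [hgG _ ⟨by linarith [this.2], by linarith [this.1]⟩]
  · rfl
  · rfl

end Paths

lemma isStoppingTime_neverRaise {Ω : Type*} [mΩ : MeasurableSpace Ω] {𝓕 : Filtration ℝ≥0 mΩ} :
    IsStoppingTime 𝓕 (neverRaise : Ω → WithTop ℝ≥0) := by
  intro i
  have : {ω : Ω | neverRaise ω ≤ (i : WithTop ℝ≥0)} = ∅ :=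
    eq_empty_of_forall_notMem fun ω h => (WithTop.coe_lt_top i).not_ge h
  rw [this]
  exact @MeasurableSet.empty _ (𝓕 i)

/-! ### Expected payoffs through affine functions of the stopped state -/

namespace IsBrownianMotion

variable {Ω : Type*} [mΩ : MeasurableSpace Ω] {P : Measure Ω} {𝓕 : Filtration ℝ≥0 mΩ}
  {B : ℝ≥0 → Ω → ℝ} {p : ℝ} {τ σ : Ω → WithTop ℝ≥0} {G : ℝ → ℝ} {tieA : Bool}

lemma isStoppingTime_stopTime (hB : IsBrownianMotion P 𝓕 B) (p : ℝ) (hτ : IsStoppingTime 𝓕 τ)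
    (hσ : IsStoppingTime 𝓕 σ) : IsStoppingTime 𝓕 (stopTime B p τ σ) :=
  (hτ.min hσ).min (hB.isStoppingTime_endTime p)

lemma stopState_mem_Icc (hB : IsBrownianMotion P 𝓕 B) (hp : p ∈ Icc (0 : ℝ) 1) :
    ∀ᵐ ω ∂P, stopState B p τ σ ω ∈ Icc (0 : ℝ) 1 := by
  filter_upwards [hB.endTime_ne_top p, hB.law.eval_zero_ae_eq_zero] with ω hend h0
  obtain ⟨t, -, hZ, hmem, -⟩ := payoff_cases (g := 0) (tieA := true) (τ := τ) (σ := σ)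
    (hB.continuous_gameState p ω) h0 hend hp
  rwa [hZ]

variable [IsProbabilityMeasure P]

lemma integrable_stopState (hB : IsBrownianMotion P 𝓕 B) (hp : p ∈ Icc (0 : ℝ) 1)
    (hτ : IsStoppingTime 𝓕 τ) (hσ : IsStoppingTime 𝓕 σ) : Integrable (stopState B p τ σ) P := by
  refine Integrable.of_bound (hB.measurable_stoppedValue_gameState p
    (hB.isStoppingTime_stopTime p hτ hσ)).aestronglyMeasurable 1 ?_
  filter_upwards [hB.stopState_mem_Icc hp] with ω hω
  rw [Real.norm_eq_abs, abs_le]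
  exact ⟨by linarith [hω.1], hω.2⟩

/-- The game state is a fair game up to the end of the current stage. -/
lemma integral_stopState (hB : IsBrownianMotion P 𝓕 B) (hp : p ∈ Icc (0 : ℝ) 1)
    (hτ : IsStoppingTime 𝓕 τ) (hσ : IsStoppingTime 𝓕 σ) :
    ∫ ω, stopState B p τ σ ω ∂P = p := by
  have hθ := hB.isStoppingTime_stopTime p hτ hσ
  set θ := stopTime B p τ σ with hθdef
  -- Optional stopping is available for bounded times only. The truncated states stay in `[0, 1]`
  -- almost surely and are eventually constant in `n`, so dominated convergence removes the
  -- truncation.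
  have hθn : ∀ n : ℕ, IsStoppingTime 𝓕 fun ω => min (θ ω) ((n : ℝ≥0) : WithTop ℝ≥0) :=
    fun n => hθ.min_const _
  have hmem : ∀ n : ℕ, ∀ᵐ ω ∂P, stoppedValue (gameState B p)
      (fun ω => min (θ ω) ((n : ℝ≥0) : WithTop ℝ≥0)) ω ∈ Icc (0 : ℝ) 1 := by
    intro n
    filter_upwards [hB.law.eval_zero_ae_eq_zero] with ω h0
    have hne : min (θ ω) ((n : ℝ≥0) : WithTop ℝ≥0) ≠ ⊤ :=
      ne_top_of_le_ne_top WithTop.coe_ne_top (min_le_right _ _)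
    obtain ⟨t, ht⟩ := WithTop.ne_top_iff_exists.1 hne
    rw [stoppedValue, ← ht, untopA_coe_eq_self]
    refine gameState_mem_Icc (hB.continuous_gameState p ω) h0 hp ?_
    rw [ht]
    exact (min_le_left _ _).trans (min_le_right _ _)
  have hval : ∀ n : ℕ, ∫ ω, stoppedValue (gameState B p)
      (fun ω => min (θ ω) ((n : ℝ≥0) : WithTop ℝ≥0)) ω ∂P = p := by
    intro n
    have hbd : ∀ᵐ ω ∂P, ‖stoppedValue B
        (fun ω => min (θ ω) ((n : ℝ≥0) : WithTop ℝ≥0)) ω‖ ≤ 1 := by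
      filter_upwards [hmem n] with ω hω
      simp only [stoppedValue, gameState, mem_Icc] at hω
      rw [Real.norm_eq_abs, abs_le]
      simp only [stoppedValue]
      exact ⟨by linarith [hω.1, hp.2], by linarith [hω.2, hp.1]⟩
    have h0 := hB.integral_stoppedValue_of_le (hθn n) (fun ω => min_le_right _ _) hbd
    have hm : Measurable (stoppedValue B fun ω => min (θ ω) ((n : ℝ≥0) : WithTop ℝ≥0)) :=
      (measurable_stoppedValue hB.isStronglyProgressive (hθn n)).mono
        (hθn n).measurableSpace_le le_rfl
    have hint := Integrable.of_bound hm.aestronglyMeasurable 1 hbd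
    have : ∀ ω, stoppedValue (gameState B p)
        (fun ω => min (θ ω) ((n : ℝ≥0) : WithTop ℝ≥0)) ω =
        p + stoppedValue B (fun ω => min (θ ω) ((n : ℝ≥0) : WithTop ℝ≥0)) ω := fun ω => rfl
    simp_rw [this]
    rw [integral_add (integrable_const p) hint, h0]
    simp
  have hlim : Tendsto (fun n : ℕ => ∫ ω, stoppedValue (gameState B p)
      (fun ω => min (θ ω) ((n : ℝ≥0) : WithTop ℝ≥0)) ω ∂P) atTop
      (𝓝 (∫ ω, stopState B p τ σ ω ∂P)) := by
    refine tendsto_integral_of_dominated_convergence (fun _ => 1)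
      (fun n => (hB.measurable_stoppedValue_gameState p (hθn n)).aestronglyMeasurable)
      (integrable_const 1) (fun n => ?_) ?_
    · filter_upwards [hmem n] with ω hω
      rw [Real.norm_eq_abs, abs_le]
      exact ⟨by linarith [hω.1], hω.2⟩
    · filter_upwards [hB.endTime_ne_top p] with ω hend
      refine tendsto_const_nhds.congr' ?_
      obtain ⟨t, ht⟩ := WithTop.ne_top_iff_exists.1
        (ne_top_of_le_ne_top hend (min_le_right _ _) : θ ω ≠ ⊤)
      obtain ⟨N, hN⟩ := exists_nat_ge t
      filter_upwards [eventually_ge_atTop N] with n hn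
      have hle : θ ω ≤ ((n : ℝ≥0) : WithTop ℝ≥0) := by
        rw [← ht, WithTop.coe_le_coe]
        exact hN.trans (Nat.cast_le.2 hn)
      simp only [stopState, stoppedValue, ← hθdef, min_eq_left hle]
  refine tendsto_nhds_unique hlim ?_
  simp_rw [hval]
  exact tendsto_const_nhds

lemma integrable_payoff (hB : IsBrownianMotion P 𝓕 B) (hp : p ∈ Icc (0 : ℝ) 1)
    (hG : Measurable G) (hbd : ∃ M, ∀ q ∈ Icc (0 : ℝ) 1, |G q| ≤ M)
    (hτ : IsStoppingTime 𝓕 τ) (hσ : IsStoppingTime 𝓕 σ) :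
    Integrable (payoff B G tieA p τ σ) P := by
  obtain ⟨M, hM⟩ := hbd
  have hE := hB.isStoppingTime_endTime p
  have hmeas : Measurable (payoff B G tieA p τ σ) := by
    unfold payoff
    refine Measurable.ite ?_ (hG.comp (hB.measurable_stoppedValue_gameState p hτ)) ?_
    · refine hτ.measurableSet_eq_top.compl.inter
        ((measurableSet_le hτ.measurable' hE.measurable').inter
          ((measurableSet_lt hτ.measurable' hσ.measurable').union ?_))
      exact ((hτ.measurableSpace_le _ (hτ.measurableSet_eq_stopping_time hσ)).inter
        (MeasurableSet.const _))
    · refine Measurable.ite ?_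
        (hG.comp (measurable_const.sub (hB.measurable_stoppedValue_gameState p hσ))).neg ?_
      · exact hσ.measurableSet_eq_top.compl.inter (measurableSet_le hσ.measurable' hE.measurable')
      · exact Measurable.ite (hB.measurable_stoppedValue_gameState p hE (measurableSet_singleton 1))
          measurable_const measurable_const
  refine Integrable.of_bound hmeas.aestronglyMeasurable (max M 1) ?_
  filter_upwards [hB.endTime_ne_top p, hB.law.eval_zero_ae_eq_zero] with ω hend h0
  obtain ⟨t, -, -, hmem, h⟩ := payoff_cases (g := G) (tieA := tieA) (τ := τ) (σ := σ)
    (hB.continuous_gameState p ω) h0 hend hp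
  rw [Real.norm_eq_abs]
  rcases h with ⟨-, -, h⟩ | ⟨-, -, h⟩ | ⟨-, -, -, ⟨-, h⟩ | ⟨-, h⟩⟩ <;> rw [h]
  · exact (hM _ hmem).trans (le_max_left _ _)
  · rw [abs_neg]
    exact (hM _ ⟨by linarith [hmem.2], by linarith [hmem.1]⟩).trans (le_max_left _ _)
  · simp
  · simp

lemma integral_affine_stopState (hB : IsBrownianMotion P 𝓕 B) (hp : p ∈ Icc (0 : ℝ) 1)
    (hτ : IsStoppingTime 𝓕 τ) (hσ : IsStoppingTime 𝓕 σ) (a b : ℝ) :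
    ∫ ω, (a + b * stopState B p τ σ ω) ∂P = a + b * p := by
  rw [integral_add (integrable_const a) ((hB.integrable_stopState hp hτ hσ).const_mul b),
    integral_const_mul, hB.integral_stopState hp hτ hσ]
  simp

/-- This turns an affine bound on each path into a bound on the expectation. Paths that do not start
at `0` or never exit form a null set and are excluded from `h`. -/
lemma integral_payoff_le (hB : IsBrownianMotion P 𝓕 B) (hp : p ∈ Icc (0 : ℝ) 1)
    (hG : Measurable G) (hbd : ∃ M, ∀ q ∈ Icc (0 : ℝ) 1, |G q| ≤ M)
    (hτ : IsStoppingTime 𝓕 τ) (hσ : IsStoppingTime 𝓕 σ) (a b : ℝ)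
    (h : ∀ ω, B 0 ω = 0 → endTime B p ω ≠ ⊤ →
      payoff B G tieA p τ σ ω ≤ a + b * stopState B p τ σ ω) :
    ∫ ω, payoff B G tieA p τ σ ω ∂P ≤ a + b * p := by
  rw [← hB.integral_affine_stopState hp hτ hσ a b]
  refine integral_mono_ae (hB.integrable_payoff hp hG hbd hτ hσ)
    ((integrable_const a).add ((hB.integrable_stopState hp hτ hσ).const_mul b)) ?_
  filter_upwards [hB.endTime_ne_top p, hB.law.eval_zero_ae_eq_zero] with ω hend h0
  exact h ω h0 hend

lemma le_integral_payoff (hB : IsBrownianMotion P 𝓕 B) (hp : p ∈ Icc (0 : ℝ) 1)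
    (hG : Measurable G) (hbd : ∃ M, ∀ q ∈ Icc (0 : ℝ) 1, |G q| ≤ M)
    (hτ : IsStoppingTime 𝓕 τ) (hσ : IsStoppingTime 𝓕 σ) (a b : ℝ)
    (h : ∀ ω, B 0 ω = 0 → endTime B p ω ≠ ⊤ →
      a + b * stopState B p τ σ ω ≤ payoff B G tieA p τ σ ω) :
    a + b * p ≤ ∫ ω, payoff B G tieA p τ σ ω ∂P := by
  rw [← hB.integral_affine_stopState hp hτ hσ a b]
  refine integral_mono_ae
    ((integrable_const a).add ((hB.integrable_stopState hp hτ hσ).const_mul b))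
    (hB.integrable_payoff hp hG hbd hτ hσ) ?_
  filter_upwards [hB.endTime_ne_top p, hB.law.eval_zero_ae_eq_zero] with ω hend h0
  exact h ω h0 hend

lemma integral_payoff_eq (hB : IsBrownianMotion P 𝓕 B) (hp : p ∈ Icc (0 : ℝ) 1)
    (hτ : IsStoppingTime 𝓕 τ) (hσ : IsStoppingTime 𝓕 σ) (a b : ℝ)
    (h : ∀ ω, B 0 ω = 0 → endTime B p ω ≠ ⊤ →
      payoff B G tieA p τ σ ω = a + b * stopState B p τ σ ω) :
    ∫ ω, payoff B G tieA p τ σ ω ∂P = a + b * p := by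
  rw [← hB.integral_affine_stopState hp hτ hσ a b]
  refine integral_congr_ae ?_
  filter_upwards [hB.endTime_ne_top p, hB.law.eval_zero_ae_eq_zero] with ω hend h0
  exact h ω h0 hend

omit [IsProbabilityMeasure P] in
lemma integral_payoff_congr (hB : IsBrownianMotion P 𝓕 B) (hp : p ∈ Icc (0 : ℝ) 1)
    {g : ℝ → ℝ} (hgG : ∀ q ∈ Icc (0 : ℝ) 1, g q = G q) :
    ∫ ω, payoff B g tieA p τ σ ω ∂P = ∫ ω, payoff B G tieA p τ σ ω ∂P := by
  refine integral_congr_ae ?_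
  filter_upwards [hB.law.eval_zero_ae_eq_zero] with ω h0
  exact payoff_congr (hB.continuous_gameState p ω) h0 hp hgG

lemma integral_payoff_neverRaise (hB : IsBrownianMotion P 𝓕 B) (hp : p ∈ Icc (0 : ℝ) 1) :
    ∫ ω, payoff B G tieA p neverRaise neverRaise ω ∂P = -1 + 2 * p := by
  refine hB.integral_payoff_eq hp isStoppingTime_neverRaise isStoppingTime_neverRaise (-1) 2
    fun ω h0 hend => ?_
  obtain ⟨t, -, hZ, -, h⟩ := payoff_cases (g := G) (tieA := tieA) (τ := neverRaise)
    (σ := neverRaise) (hB.continuous_gameState p ω) h0 hend hp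
  rw [hZ]
  rcases h with ⟨h, -⟩ | ⟨h, -⟩ | ⟨-, -, -, ⟨h1, h⟩ | ⟨h1, h⟩⟩
  · exact absurd h WithTop.top_ne_coe
  · exact absurd h WithTop.top_ne_coe
  · rw [h, h1]
    norm_num
  · rw [h, h1]
    norm_num

lemma integral_payoff_raiseAt_of_le (hB : IsBrownianMotion P 𝓕 B) {c : ℝ} (hc0 : 0 < c)
    (hc1 : c ≤ 1) (hp : p ∈ Icc 0 c) :
    ∫ ω, payoff B G tieA p (raiseAt B p c) neverRaise ω ∂P = -1 + (1 + G c) / c * p := by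
  have hp1 : p ∈ Icc (0 : ℝ) 1 := ⟨hp.1, hp.2.trans hc1⟩
  refine hB.integral_payoff_eq hp1 (hB.isStoppingTime_raiseAt p c) isStoppingTime_neverRaise _ _
    fun ω h0 hend => ?_
  have hcont := hB.continuous_gameState p ω
  obtain ⟨t, -, hZ, -, h⟩ := payoff_cases (g := G) (tieA := tieA) (τ := raiseAt B p c)
    (σ := neverRaise) hcont h0 hend hp1
  rw [hZ]
  rcases h with ⟨h, -, h1⟩ | ⟨h, -⟩ | ⟨-, hlt, -, ⟨h1, -⟩ | ⟨h1, h⟩⟩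
  · rw [h1, gameState_raiseAt hcont h]
    field_simp
    ring
  · exact absurd h WithTop.top_ne_coe
  · exact absurd (raiseAt_le hcont h0 (by rw [h1]; exact mem_uIcc.2 (Or.inl ⟨hp.2, hc1⟩)))
      hlt.not_ge
  · rw [h, h1]
    ring

lemma integral_payoff_raiseAt_of_ge (hB : IsBrownianMotion P 𝓕 B) {c : ℝ} (hc0 : 0 ≤ c)
    (hc1 : c < 1) (hp : p ∈ Icc c 1) :
    ∫ ω, payoff B G tieA p (raiseAt B p c) neverRaise ω ∂P =
      (G c - (1 - G c) / (1 - c) * c) + (1 - G c) / (1 - c) * p := by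
  have hp1 : p ∈ Icc (0 : ℝ) 1 := ⟨hc0.trans hp.1, hp.2⟩
  refine hB.integral_payoff_eq hp1 (hB.isStoppingTime_raiseAt p c) isStoppingTime_neverRaise _ _
    fun ω h0 hend => ?_
  have hcont := hB.continuous_gameState p ω
  have hc' : 1 - c ≠ 0 := by linarith
  obtain ⟨t, -, hZ, -, h⟩ := payoff_cases (g := G) (tieA := tieA) (τ := raiseAt B p c)
    (σ := neverRaise) hcont h0 hend hp1
  rw [hZ]
  rcases h with ⟨h, -, h1⟩ | ⟨h, -⟩ | ⟨-, hlt, -, ⟨h1, h⟩ | ⟨h1, -⟩⟩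
  · rw [h1, gameState_raiseAt hcont h]
    ring
  · exact absurd h WithTop.top_ne_coe
  · rw [h, h1]
    field_simp
    ring
  · exact absurd (raiseAt_le hcont h0 (by rw [h1]; exact mem_uIcc.2 (Or.inr ⟨hc0, hp.1⟩)))
      hlt.not_ge

lemma integral_payoff_raiseAt_self (hB : IsBrownianMotion P 𝓕 B) (hp : p ∈ Icc (0 : ℝ) 1) :
    ∫ ω, payoff B G tieA p (raiseAt B p p) neverRaise ω ∂P = G p := by
  have := hB.integral_payoff_eq (G := G) (tieA := tieA) hp (hB.isStoppingTime_raiseAt p p)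
    isStoppingTime_neverRaise (G p) 0 fun ω h0 hend => ?_
  · rw [this]
    ring
  have hcont := hB.continuous_gameState p ω
  obtain ⟨t, -, -, -, h⟩ := payoff_cases (g := G) (tieA := tieA) (τ := raiseAt B p p)
    (σ := neverRaise) hcont h0 hend hp
  rcases h with ⟨h, -, h1⟩ | ⟨h, -⟩ | ⟨-, hlt, -⟩
  · rw [h1, gameState_raiseAt hcont h]
    ring
  · exact absurd h WithTop.top_ne_coe
  · exact absurd (raiseAt_le hcont h0 left_mem_uIcc) hlt.not_ge

end IsBrownianMotion

/-! ### Optimality from the shape of the proposal value -/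

/-- The properties of the value `G` of a proposal, as a function of the proposer's own state, that
make `d` the optimal state to raise. -/
structure IsRaiseReward (x d : ℝ) (G : ℝ → ℝ) : Prop where
  half_lt : 1 / 2 < d
  lt_one : d < 1
  two_mul_lt : 2 * d < 1 + x
  measurable : Measurable G
  bounded : ∃ M, ∀ q ∈ Icc (0 : ℝ) 1, |G q| ≤ M
  eq_of_ge : ∀ q ∈ Icc d 1, G q = x
  lt_of_lt : ∀ q ∈ Ico 0 d, G q < -1 + (1 + x) / d * q
  le_of_mem : ∀ q ∈ Icc (1 - d) d, G q ≤ -(x / (2 * d - 1)) + 2 * x / (2 * d - 1) * q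

/-- The value of the game to the holder of the cube in own state `s`, if `d` is the optimal state to
raise. -/
def holderFormula (x d s : ℝ) : ℝ :=
  if s ≤ d then -1 + (1 + x) / d * s
  else x - max (1 - x) 0 / (1 - d) * d + max (1 - x) 0 / (1 - d) * s

namespace IsRaiseReward

variable {x d : ℝ} {G : ℝ → ℝ}

lemma pos (h : IsRaiseReward x d G) : 0 < d := by linarith [h.half_lt]

lemma stake_pos (h : IsRaiseReward x d G) : 0 < x := by linarith [h.half_lt, h.two_mul_lt]

lemma two_lt (h : IsRaiseReward x d G) : 2 < (1 + x) / d := by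
  rw [lt_div_iff₀ h.pos]
  exact h.two_mul_lt

lemma apply_self (h : IsRaiseReward x d G) : G d = x := h.eq_of_ge d ⟨le_rfl, h.lt_one.le⟩

lemma le_line (h : IsRaiseReward x d G) {q : ℝ} (hq : q ∈ Icc (0 : ℝ) 1) :
    G q ≤ -1 + (1 + x) / d * q := by
  rcases lt_or_ge q d with hqd | hqd
  · exact (h.lt_of_lt q ⟨hq.1, hqd⟩).le
  · rw [h.eq_of_ge q ⟨hqd, hq.2⟩]
    have h1 : (1 + x) / d * d = 1 + x := div_mul_cancel₀ _ h.pos.ne'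
    have h2 : (1 + x) / d * d ≤ (1 + x) / d * q :=
      mul_le_mul_of_nonneg_left hqd (by linarith [h.two_lt])
    linarith

lemma le_stake (h : IsRaiseReward x d G) {q : ℝ} (hq : q ∈ Icc (0 : ℝ) 1) : G q ≤ x := by
  rcases lt_or_ge q d with hqd | hqd
  · have h0 := h.lt_of_lt q ⟨hq.1, hqd⟩
    have h1 : (1 + x) / d * d = 1 + x := div_mul_cancel₀ _ h.pos.ne'
    have h2 : (1 + x) / d * q ≤ (1 + x) / d * d :=
      mul_le_mul_of_nonneg_left hqd.le (by linarith [h.two_lt])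
    linarith
  · exact (h.eq_of_ge q ⟨hqd, hq.2⟩).le

/-- The chord from `(d, x)` to `(1, 1)` is less steep than the one from `(0, -1)` to `(d, x)`. -/
lemma slope_le (h : IsRaiseReward x d G) : (1 - x) / (1 - d) ≤ (1 + x) / d := by
  rw [div_le_div_iff₀ (by linarith [h.lt_one]) h.pos]
  nlinarith [h.two_mul_lt]

lemma le_chord (h : IsRaiseReward x d G) (hx : x < 1) {q : ℝ} (hq : q ∈ Icc (0 : ℝ) 1) :
    G q ≤ x - (1 - x) / (1 - d) * d + (1 - x) / (1 - d) * q := by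
  rcases lt_or_ge q d with hqd | hqd
  · have h0 := h.lt_of_lt q ⟨hq.1, hqd⟩
    have h1 : (1 + x) / d * d = 1 + x := div_mul_cancel₀ _ h.pos.ne'
    nlinarith [mul_nonneg (sub_nonneg.2 h.slope_le) (sub_nonneg.2 hqd.le)]
  · rw [h.eq_of_ge q ⟨hqd, hq.2⟩]
    have : 0 ≤ (1 - x) / (1 - d) := div_nonneg (by linarith) (by linarith [h.lt_one])
    nlinarith [mul_nonneg this (sub_nonneg.2 hqd)]

/-- The line of the open game written around `(d, x)`; `open_line_eq'` writes it around `(1 - d,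
-x)`. Together they show its antisymmetry under `q ↦ 1 - q`. -/
lemma open_line_eq (h : IsRaiseReward x d G) (q : ℝ) :
    -(x / (2 * d - 1)) + 2 * x / (2 * d - 1) * q = x + 2 * x / (2 * d - 1) * (q - d) := by
  have : 2 * d - 1 ≠ 0 := by linarith [h.half_lt]
  field_simp
  ring

lemma open_line_eq' (h : IsRaiseReward x d G) (q : ℝ) :
    -(x / (2 * d - 1)) + 2 * x / (2 * d - 1) * q = -x + 2 * x / (2 * d - 1) * (q - (1 - d)) := by
  have : 2 * d - 1 ≠ 0 := by linarith [h.half_lt]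
  field_simp
  ring

lemma open_slope_nonneg (h : IsRaiseReward x d G) : 0 ≤ 2 * x / (2 * d - 1) :=
  div_nonneg (by linarith [h.stake_pos]) (by linarith [h.half_lt])

lemma one_le_div (h : IsRaiseReward x d G) : 1 ≤ x / (2 * d - 1) := by
  rw [one_le_div₀ (by linarith [h.half_lt])]
  linarith [h.two_mul_lt]

lemma le_open_line (h : IsRaiseReward x d G) {q : ℝ} (hq : q ∈ Icc (1 - d) 1) :
    G q ≤ -(x / (2 * d - 1)) + 2 * x / (2 * d - 1) * q := by
  rcases le_total q d with hqd | hqd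
  · exact h.le_of_mem q ⟨hq.1, hqd⟩
  · rw [h.eq_of_ge q ⟨hqd, hq.2⟩, h.open_line_eq]
    linarith [mul_nonneg h.open_slope_nonneg (sub_nonneg.2 hqd)]

section Brownian

variable {Ω : Type*} [mΩ : MeasurableSpace Ω] {P : Measure Ω} [IsProbabilityMeasure P]
  {𝓕 : Filtration ℝ≥0 mΩ} {B : ℝ≥0 → Ω → ℝ} {p : ℝ} {τ σ : Ω → WithTop ℝ≥0} {tieA : Bool}

/-- The conditions `h0` and `h1` make the line dominate the payoffs `-1` and `1` when the stage ends
at `0` or `1` without a proposal. -/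
lemma integral_payoff_le_of_majorant (h : IsRaiseReward x d G) (hB : IsBrownianMotion P 𝓕 B)
    (hp : p ∈ Icc (0 : ℝ) 1) (hτ : IsStoppingTime 𝓕 τ) {a b : ℝ}
    (hG : ∀ q ∈ Icc (0 : ℝ) 1, G q ≤ a + b * q) (h0 : -1 ≤ a) (h1 : 1 ≤ a + b) :
    ∫ ω, payoff B G tieA p τ neverRaise ω ∂P ≤ a + b * p := by
  refine hB.integral_payoff_le hp h.measurable h.bounded hτ isStoppingTime_neverRaise a b
    fun ω hω hend => ?_
  obtain ⟨t, -, hZ, hmem, hcase⟩ := payoff_cases (g := G) (tieA := tieA) (τ := τ)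
    (σ := neverRaise) (hB.continuous_gameState p ω) hω hend hp
  rw [hZ]
  rcases hcase with ⟨-, -, e⟩ | ⟨e, -⟩ | ⟨-, -, -, ⟨e1, e⟩ | ⟨e1, e⟩⟩
  · rw [e]
    exact hG _ hmem
  · exact absurd e WithTop.top_ne_coe
  · rw [e, e1]
    linarith
  · rw [e, e1]
    linarith

lemma integral_payoff_le_line (h : IsRaiseReward x d G) (hB : IsBrownianMotion P 𝓕 B)
    (hp : p ∈ Icc (0 : ℝ) 1) (hτ : IsStoppingTime 𝓕 τ) :
    ∫ ω, payoff B G tieA p τ neverRaise ω ∂P ≤ -1 + (1 + x) / d * p :=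
  h.integral_payoff_le_of_majorant hB hp hτ (fun _ => h.le_line) le_rfl (by linarith [h.two_lt])

lemma integral_payoff_raiseAt (h : IsRaiseReward x d G) (hB : IsBrownianMotion P 𝓕 B)
    (hp : p ∈ Icc 0 d) :
    ∫ ω, payoff B G tieA p (raiseAt B p d) neverRaise ω ∂P = -1 + (1 + x) / d * p := by
  rw [hB.integral_payoff_raiseAt_of_le h.pos h.lt_one.le hp, h.apply_self]

/-- The value of one proposal round to the holder of the cube. -/
lemma sSup_payoff_eq (h : IsRaiseReward x d G) (hB : IsBrownianMotion P 𝓕 B)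
    (hp : p ∈ Icc (0 : ℝ) 1) :
    sSup {v | ∃ τ : Ω → WithTop ℝ≥0, IsStoppingTime 𝓕 τ ∧
      v = ∫ ω, payoff B G tieA p τ neverRaise ω ∂P} = holderFormula x d p := by
  refine IsGreatest.csSup_eq ?_
  unfold holderFormula
  split_ifs with hpd
  · refine ⟨⟨_, hB.isStoppingTime_raiseAt p d, (h.integral_payoff_raiseAt hB ⟨hp.1, hpd⟩).symm⟩, ?_⟩
    rintro _ ⟨τ, hτ, rfl⟩
    exact h.integral_payoff_le_line hB hp hτ
  push Not at hpd
  -- Beyond `d` a raise yields `x` wherever it is made. If `x < 1` it is best to play for a win and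
  -- raise only on falling back to `d`; if `x ≥ 1`, raising at once is best.
  rcases lt_or_ge x 1 with hx | hx
  · rw [max_eq_left (by linarith)]
    refine ⟨⟨_, hB.isStoppingTime_raiseAt p d, ?_⟩, ?_⟩
    · rw [hB.integral_payoff_raiseAt_of_ge h.pos.le h.lt_one ⟨hpd.le, hp.2⟩, h.apply_self]
    rintro _ ⟨τ, hτ, rfl⟩
    have h1 : (1 - x) / (1 - d) * (1 - d) = 1 - x :=
      div_mul_cancel₀ _ (by linarith [h.lt_one])
    have h2 : (1 + x) / d * d = 1 + x := div_mul_cancel₀ _ h.pos.ne'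
    refine h.integral_payoff_le_of_majorant hB hp hτ (fun _ => h.le_chord hx) ?_ (by linarith)
    linarith [mul_le_mul_of_nonneg_right h.slope_le h.pos.le]
  · rw [max_eq_right (by linarith), zero_div, zero_mul, zero_mul, sub_zero, add_zero]
    refine ⟨⟨_, hB.isStoppingTime_raiseAt p p, ?_⟩, ?_⟩
    · rw [hB.integral_payoff_raiseAt_self hp, h.eq_of_ge p ⟨hpd.le, hp.2⟩]
    rintro _ ⟨τ, hτ, rfl⟩
    have := h.integral_payoff_le_of_majorant (tieA := tieA) (a := x) (b := 0) hB hp hτ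
      (fun q hq => by linarith [h.le_stake hq]) (by linarith) (by linarith)
    linarith

/-- `d` is the only state from which raising on the first visit is optimal for the holder of the
cube. -/
lemma optimal_iff (h : IsRaiseReward x d G) (hB : IsBrownianMotion P 𝓕 B) (e : ℝ) :
    (e ∈ Icc (0 : ℝ) 1 ∧ ∀ p ∈ Icc 0 e, ∀ τ : Ω → WithTop ℝ≥0, IsStoppingTime 𝓕 τ →
      ∫ ω, payoff B G true p τ neverRaise ω ∂P ≤
        ∫ ω, payoff B G true p (raiseAt B p e) neverRaise ω ∂P) ↔ e = d := by
  constructor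
  · rintro ⟨he, hopt⟩
    rcases lt_trichotomy e d with hlt | heq | hgt
    -- For `e < d`, waiting for `d` from state `e` is strictly better than raising there.
    · have h1 := hopt e ⟨he.1, le_rfl⟩ _ (hB.isStoppingTime_raiseAt e d)
      rw [h.integral_payoff_raiseAt hB ⟨he.1, hlt.le⟩, hB.integral_payoff_raiseAt_self he] at h1
      exact absurd (h.lt_of_lt e ⟨he.1, hlt⟩) h1.not_gt
    · exact heq
    -- For `e > d`, raising at once from `d` already secures `x`, whereas waiting for `e` risks a
    -- loss for the same reward.
    · have h1 := hopt d ⟨h.pos.le, hgt.le⟩ _ (hB.isStoppingTime_raiseAt d d)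
      have he0 : 0 < e := h.pos.trans hgt
      rw [hB.integral_payoff_raiseAt_self ⟨h.pos.le, h.lt_one.le⟩,
        hB.integral_payoff_raiseAt_of_le he0 he.2 ⟨h.pos.le, hgt.le⟩, h.apply_self,
        h.eq_of_ge e ⟨hgt.le, he.2⟩] at h1
      have h2 : (1 + x) / e * e = 1 + x := div_mul_cancel₀ _ he0.ne'
      have h3 : (1 + x) / e * d < (1 + x) / e * e :=
        mul_lt_mul_of_pos_left hgt (div_pos (by linarith [h.stake_pos]) he0)
      linarith
  · rintro rfl
    refine ⟨⟨h.pos.le, h.lt_one.le⟩, fun p hp τ hτ => ?_⟩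
    rw [h.integral_payoff_raiseAt hB hp]
    exact h.integral_payoff_le_line hB ⟨hp.1, hp.2.trans h.lt_one.le⟩ hτ

lemma mem_Icc_zero_one (h : IsRaiseReward x d G) (hp : p ∈ Icc (1 - d) d) : p ∈ Icc (0 : ℝ) 1 :=
  ⟨by linarith [hp.1, h.lt_one], by linarith [hp.2, h.lt_one]⟩

/-- The expected payoff if both players raise on the first visit to own state `d`. -/
lemma integral_payoff_open (h : IsRaiseReward x d G) (hB : IsBrownianMotion P 𝓕 B)
    (hp : p ∈ Icc (1 - d) d) :
    ∫ ω, payoff B G tieA p (raiseAt B p d) (raiseAt B p (1 - d)) ω ∂P =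
      -(x / (2 * d - 1)) + 2 * x / (2 * d - 1) * p := by
  have hp1 := h.mem_Icc_zero_one hp
  refine hB.integral_payoff_eq hp1 (hB.isStoppingTime_raiseAt p d)
    (hB.isStoppingTime_raiseAt p (1 - d)) _ _ fun ω hω hend => ?_
  have hcont := hB.continuous_gameState p ω
  obtain ⟨t, -, hZ, -, hcase⟩ := payoff_cases (g := G) (tieA := tieA) (τ := raiseAt B p d)
    (σ := raiseAt B p (1 - d)) hcont hω hend hp1
  rw [hZ]
  rcases hcase with ⟨e1, -, e⟩ | ⟨e1, -, e⟩ | ⟨-, hA, hS, ⟨e1, -⟩ | ⟨e1, -⟩⟩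
  · rw [e, gameState_raiseAt hcont e1, h.apply_self, h.open_line_eq]
    ring
  · rw [e, gameState_raiseAt hcont e1, sub_sub_cancel, h.apply_self, h.open_line_eq']
    ring
  · exact absurd (raiseAt_le hcont hω
      (by rw [e1]; exact mem_uIcc.2 (Or.inl ⟨hp.2, h.lt_one.le⟩))) hA.not_ge
  · exact absurd (raiseAt_le hcont hω
      (by rw [e1]; exact mem_uIcc.2 (Or.inr ⟨by linarith [h.lt_one], hp.1⟩))) hS.not_ge

lemma integral_payoff_le_open (h : IsRaiseReward x d G) (hB : IsBrownianMotion P 𝓕 B)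
    (hp : p ∈ Icc (1 - d) d) (hτ : IsStoppingTime 𝓕 τ) :
    ∫ ω, payoff B G tieA p τ (raiseAt B p (1 - d)) ω ∂P ≤
      -(x / (2 * d - 1)) + 2 * x / (2 * d - 1) * p := by
  have hp1 := h.mem_Icc_zero_one hp
  refine hB.integral_payoff_le hp1 h.measurable h.bounded hτ
    (hB.isStoppingTime_raiseAt p (1 - d)) _ _ fun ω hω hend => ?_
  have hcont := hB.continuous_gameState p ω
  obtain ⟨t, -, hZ, hmem, hcase⟩ := payoff_cases (g := G) (tieA := tieA) (τ := τ)
    (σ := raiseAt B p (1 - d)) hcont hω hend hp1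
  rw [hZ]
  rcases hcase with ⟨-, hle, e⟩ | ⟨e1, -, e⟩ | ⟨-, -, hS, ⟨e1, e⟩ | ⟨e1, -⟩⟩
  · rw [e]
    -- The opponent's plan keeps the state above `1 - d` until then, so the line need not dominate
    -- `G` below `1 - d`.
    exact h.le_open_line ⟨le_gameState_of_le_raiseAt hcont hω hp.1 hle, hmem.2⟩
  · rw [e, gameState_raiseAt hcont e1, sub_sub_cancel, h.apply_self, h.open_line_eq']
    linarith
  · have h2 : 2 * x / (2 * d - 1) = 2 * (x / (2 * d - 1)) := mul_div_assoc _ _ _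
    rw [e, e1, h2]
    linarith [h.one_le_div]
  · exact absurd (raiseAt_le hcont hω
      (by rw [e1]; exact mem_uIcc.2 (Or.inr ⟨by linarith [h.lt_one], hp.1⟩))) hS.not_ge

lemma open_le_integral_payoff (h : IsRaiseReward x d G) (hB : IsBrownianMotion P 𝓕 B)
    (hp : p ∈ Icc (1 - d) d) (hσ : IsStoppingTime 𝓕 σ) :
    -(x / (2 * d - 1)) + 2 * x / (2 * d - 1) * p ≤
      ∫ ω, payoff B G tieA p (raiseAt B p d) σ ω ∂P := by
  have hp1 := h.mem_Icc_zero_one hp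
  refine hB.le_integral_payoff hp1 h.measurable h.bounded (hB.isStoppingTime_raiseAt p d) hσ
    _ _ fun ω hω hend => ?_
  have hcont := hB.continuous_gameState p ω
  obtain ⟨t, -, hZ, hmem, hcase⟩ := payoff_cases (g := G) (tieA := tieA) (τ := raiseAt B p d)
    (σ := σ) hcont hω hend hp1
  rw [hZ]
  rcases hcase with ⟨e1, -, e⟩ | ⟨-, hle, e⟩ | ⟨-, hA, -, ⟨e1, -⟩ | ⟨e1, e⟩⟩
  · rw [e, gameState_raiseAt hcont e1, h.apply_self, h.open_line_eq]
    linarith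
  · have hle' := gameState_le_of_le_raiseAt hcont hω hp.2 hle
    -- Player B's deviation is bounded by the same inequality at B's own state, by antisymmetry of
    -- the line.
    have := h.le_open_line (q := 1 - gameState B p t ω) ⟨by linarith, by linarith [hmem.1]⟩
    rw [h.open_line_eq'] at this
    rw [e, h.open_line_eq]
    linarith
  · exact absurd (raiseAt_le hcont hω
      (by rw [e1]; exact mem_uIcc.2 (Or.inl ⟨hp.2, h.lt_one.le⟩))) hA.not_ge
  · rw [e, e1]
    linarith [h.one_le_div]

/-- Raising at own state `d` is strictly better than not raising, against an opponent who raises at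
own state `d`. -/
lemma integral_payoff_neverRaise_lt_open (h : IsRaiseReward x d G) (hB : IsBrownianMotion P 𝓕 B)
    (hp : p ∈ Ioc (1 - d) d) :
    ∫ ω, payoff B G tieA p neverRaise (raiseAt B p (1 - d)) ω ∂P <
      ∫ ω, payoff B G tieA p (raiseAt B p d) (raiseAt B p (1 - d)) ω ∂P := by
  have hp' : p ∈ Icc (1 - d) d := ⟨hp.1.le, hp.2⟩
  have hp1 := h.mem_Icc_zero_one hp'
  have hd := h.pos
  -- Without raising, the payoff follows the line through `(1 - d, -x)` and `(1, 1)`. The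
  -- equilibrium line starts from the same point and is steeper because `2 * d < 1 + x`.
  have hval : ∫ ω, payoff B G tieA p neverRaise (raiseAt B p (1 - d)) ω ∂P =
      1 - (1 + x) / d + (1 + x) / d * p := by
    refine hB.integral_payoff_eq hp1 isStoppingTime_neverRaise
      (hB.isStoppingTime_raiseAt p (1 - d)) _ _ fun ω hω hend => ?_
    have hcont := hB.continuous_gameState p ω
    obtain ⟨t, -, hZ, hmem, hcase⟩ := payoff_cases (g := G) (tieA := tieA) (τ := neverRaise)
      (σ := raiseAt B p (1 - d)) hcont hω hend hp1
    rw [hZ]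
    rcases hcase with ⟨e, -⟩ | ⟨e1, -, e⟩ | ⟨-, -, hS, ⟨e1, e⟩ | ⟨e1, -⟩⟩
    · exact absurd e WithTop.top_ne_coe
    · rw [e, gameState_raiseAt hcont e1, sub_sub_cancel, h.apply_self]
      field_simp
      ring
    · rw [e, e1]
      ring
    · exact absurd (raiseAt_le hcont hω
        (by rw [e1]; exact mem_uIcc.2 (Or.inr ⟨by linarith [h.lt_one], hp.1.le⟩))) hS.not_ge
  rw [hval, h.integral_payoff_open hB hp', h.open_line_eq']
  have hslope : (1 + x) / d < 2 * x / (2 * d - 1) := by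
    rw [div_lt_div_iff₀ hd (by linarith [h.half_lt])]
    linarith [h.two_mul_lt]
  have h2 : (1 + x) / d * d = 1 + x := div_mul_cancel₀ _ hd.ne'
  have h3 : (1 + x) / d * (p - (1 - d)) < 2 * x / (2 * d - 1) * (p - (1 - d)) :=
    mul_lt_mul_of_pos_right hslope (by linarith [hp.1])
  linarith

end Brownian

end IsRaiseReward

/-! ### The recursion for the raising states and its bounds -/

section RaisePoint

variable {x y : ℝ}

lemma raisePoint_zero (hx : 0 < x) (hxy : x < y) (hy : 1 < y) :
    raisePoint x y 0 = (1 + x) / 2 := by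
  have : y * (2 + x) - x ≠ 0 := by nlinarith [mul_pos hx (by linarith : 0 < y - 1)]
  rw [raisePoint, pow_zero]
  field_simp
  ring

lemma raisePoint_succ (hx : 0 < x) (hxy : x < y) (hy : 1 < y) (k : ℕ) :
    raisePoint x y (k + 1) = 1 - (y - x) / (y * (1 + x)) * raisePoint x y k := by
  have h1 : y * (2 + x) - x ≠ 0 := by nlinarith [mul_pos hx (by linarith : 0 < y - 1)]
  have h2 : y ≠ 0 := by linarith
  have h3 : 1 + x ≠ 0 := by linarith
  rw [raisePoint, raisePoint, pow_succ]
  generalize (-((y - x) / (y * (1 + x)))) ^ k = z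
  field_simp
  ring

/-- The recursion is a decreasing affine map. It sends the upper end to the lower end, and the lower
end strictly below the upper one because `x ^ 2 * (y ^ 2 - 1) > 0`; so the interval is invariant. -/
lemma raisePoint_mem (hx : 0 < x) (hxy : x < y) (hy : 1 < y) (k : ℕ) :
    (x + y) / (2 * y) ≤ raisePoint x y k ∧ raisePoint x y k ≤ (1 + x) / 2 := by
  have hy0 : 0 < y := by linarith
  have hr : 0 < (y - x) / (y * (1 + x)) := div_pos (by linarith) (by positivity)
  induction k with
  | zero =>
    rw [raisePoint_zero hx hxy hy, div_le_div_iff₀ (by positivity) two_pos]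
    exact ⟨by nlinarith, le_rfl⟩
  | succ k ih =>
    rw [raisePoint_succ hx hxy hy]
    constructor
    · have h1 : (y - x) / (y * (1 + x)) * ((1 + x) / 2) = 1 - (x + y) / (2 * y) := by
        field_simp
        ring
      nlinarith [mul_le_mul_of_nonneg_left ih.2 hr.le]
    · have h1 : 1 - (1 + x) / 2 ≤ (y - x) / (y * (1 + x)) * ((x + y) / (2 * y)) := by
        rw [div_mul_div_comm, le_div_iff₀ (by positivity)]
        nlinarith [mul_pos (mul_pos hx hx) (by nlinarith : 0 < y ^ 2 - 1)]
      nlinarith [mul_le_mul_of_nonneg_left ih.1 hr.le]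

lemma raisePoint_succ_lt (hx : 0 < x) (hxy : x < y) (hy : 1 < y) (k : ℕ) :
    raisePoint x y (k + 1) < (1 + x) / 2 := by
  have hy0 : 0 < y := by linarith
  have hr : 0 < (y - x) / (y * (1 + x)) := div_pos (by linarith) (by positivity)
  rw [raisePoint_succ hx hxy hy]
  have h1 : 1 - (1 + x) / 2 < (y - x) / (y * (1 + x)) * ((x + y) / (2 * y)) := by
    rw [div_mul_div_comm, lt_div_iff₀ (by positivity)]
    nlinarith [mul_pos (mul_pos hx hx) (by nlinarith : 0 < y ^ 2 - 1)]
  nlinarith [mul_le_mul_of_nonneg_left (raisePoint_mem hx hxy hy k).1 hr.le]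

lemma raisePoint_pos (hx : 0 < x) (hxy : x < y) (hy : 1 < y) (k : ℕ) : 0 < raisePoint x y k :=
  (div_pos (by linarith) (by linarith)).trans_le (raisePoint_mem hx hxy hy k).1

lemma half_lt_raisePoint (hx : 0 < x) (hxy : x < y) (hy : 1 < y) (k : ℕ) :
    1 / 2 < raisePoint x y k := by
  refine lt_of_lt_of_le ?_ (raisePoint_mem hx hxy hy k).1
  rw [div_lt_div_iff₀ two_pos (by linarith)]
  linarith

lemma raisePoint_succ_lt_one (hx : 0 < x) (hxy : x < y) (hy : 1 < y) (k : ℕ) :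
    raisePoint x y (k + 1) < 1 := by
  have hy0 : 0 < y := by linarith
  have hr : 0 < (y - x) / (y * (1 + x)) := div_pos (by linarith) (by positivity)
  rw [raisePoint_succ hx hxy hy]
  linarith [mul_pos hr (raisePoint_pos hx hxy hy k)]

end RaisePoint

/-! ### The proposal value has the required shape -/

section Reward

variable {x y d : ℝ}

lemma stake_le_holderFormula {s : ℝ} (hs : s ≤ 1) (hds : d < s) :
    x ≤ holderFormula x d s := by
  rw [holderFormula, if_neg hds.not_ge]
  have : 0 ≤ max (1 - x) 0 / (1 - d) := div_nonneg (le_max_right _ _) (by linarith)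
  nlinarith [mul_nonneg this (sub_nonneg.2 hds.le)]

/-- The line `2 * s - 1` takes the value `x` at `(1 + x) / 2`. If `x ≥ 1` this point is not below
`1`, and the second branch is never reached. -/
lemma holderFormula_half (hx : 0 < x) {s : ℝ} (hs : s ≤ 1) :
    holderFormula x ((1 + x) / 2) s = -1 + 2 * s := by
  unfold holderFormula
  split_ifs with h
  · field_simp
  · have hx1 : 1 - x ≠ 0 := by linarith
    rw [max_eq_left (by linarith), show (1 : ℝ) - (1 + x) / 2 = (1 - x) / 2 by ring]
    field_simp
    ring

lemma measurable_holderFormula : Measurable (holderFormula x d) := by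
  unfold holderFormula
  exact Measurable.ite measurableSet_Iic (by fun_prop) (by fun_prop)

lemma holderFormula_le (hx : 0 < x) (hd : 0 < d) {s : ℝ} (hs : s ≤ 1) :
    holderFormula x d s ≤ x + max (1 - x) 0 := by
  unfold holderFormula
  split_ifs with h
  · have h1 : (1 + x) / d * d = 1 + x := div_mul_cancel₀ _ hd.ne'
    have h2 : (1 + x) / d * s ≤ (1 + x) / d * d := mul_le_mul_of_nonneg_left h (by positivity)
    linarith [le_max_right (1 - x) 0]
  · have h1 : max (1 - x) 0 / (1 - d) * (1 - d) = max (1 - x) 0 :=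
      div_mul_cancel₀ _ (by linarith)
    have h2 : max (1 - x) 0 / (1 - d) * s ≤ max (1 - x) 0 / (1 - d) * 1 :=
      mul_le_mul_of_nonneg_left hs (div_nonneg (le_max_right _ _) (by linarith))
    linarith

/-- The value of a proposal if the opponent, when accepting, has the optimal state to raise `d`. -/
lemma isRaiseReward (hx : 0 < x) (hxy : x < y) (hy : 1 < y) (k : ℕ) :
    IsRaiseReward x (raisePoint x y (k + 1))
      fun q => min x (-(y * holderFormula x (raisePoint x y k) (1 - q))) := by
  have hy0 : 0 < y := by linarith
  have hsucc := raisePoint_succ hx hxy hy k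
  have hc0 := raisePoint_pos hx hxy hy k
  have hcle := (raisePoint_mem hx hxy hy k).2
  have hdge := (raisePoint_mem hx hxy hy (k + 1)).1
  have hd1 := raisePoint_succ_lt_one hx hxy hy k
  have hdhalf := half_lt_raisePoint hx hxy hy (k + 1)
  have hdlt := raisePoint_succ_lt hx hxy hy k
  set c := raisePoint x y k
  set d := raisePoint x y (k + 1)
  have hd0 : 0 < d := by linarith
  have hr : (y - x) / (y * (1 + x)) * c = 1 - d := by linarith
  have hrc : 1 - d < c := by
    rw [← hr]
    refine mul_lt_of_lt_one_left hc0 ?_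
    rw [div_lt_one (by positivity)]
    nlinarith [mul_pos hx hy0]
  -- the opponent is indifferent at `d`
  have hline : ∀ s, y * (-1 + (1 + x) / c * s) = -x + y * (1 + x) / c * (s - (1 - d)) := by
    intro s
    rw [← hr]
    field_simp
    ring
  -- From `2 * c ≤ 1 + x < x + y ≤ 2 * y * d`. It makes the accepting line steeper than the holder's
  -- line; both pass through `(d, x)`.
  have hyd : c < y * d := by
    rw [div_le_iff₀ (by positivity)] at hdge
    linarith
  refine ⟨hdhalf, hd1, by linarith, ?_, ?_, ?_, ?_, ?_⟩
  · exact measurable_const.min (measurable_const.mul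
      (measurable_holderFormula.comp (measurable_const.sub measurable_id))).neg
  · refine ⟨x + y * (x + max (1 - x) 0), fun q hq => ?_⟩
    have h1 := mul_le_mul_of_nonneg_left
      (holderFormula_le hx hc0 (show 1 - q ≤ 1 by linarith [hq.1])) hy0.le
    have h2 : 0 ≤ y * (x + max (1 - x) 0) :=
      mul_nonneg hy0.le (add_nonneg hx.le (le_max_right _ _))
    rw [abs_le]
    exact ⟨le_min (by linarith) (by linarith), (min_le_left _ _).trans (by linarith)⟩
  · intro q hq
    refine min_eq_left ?_
    rw [holderFormula, if_pos (by linarith [hq.1]), hline]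
    have : 0 ≤ y * (1 + x) / c := by positivity
    nlinarith [mul_nonneg this (sub_nonneg.2 hq.1)]
  · intro q hq
    refine (min_le_right _ _).trans_lt ?_
    have hslope : 0 < y * (1 + x) / c - (1 + x) / d := by
      rw [sub_pos, div_lt_div_iff₀ hd0 hc0]
      nlinarith
    have hdd : (1 + x) / d * d = 1 + x := div_mul_cancel₀ _ hd0.ne'
    have hleft : ∀ s, 1 - d < s → 0 < y * (-1 + (1 + x) / c * s) - 1 + (1 + x) / d * (1 - s) := by
      intro s hs
      rw [hline]
      nlinarith [mul_pos hslope (sub_pos.2 hs)]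
    rcases le_or_gt (1 - q) c with hqc | hqc
    · rw [holderFormula, if_pos hqc]
      have := hleft (1 - q) (by linarith [hq.2])
      rw [sub_sub_cancel] at this
      linarith
    · have hFc := hleft c hrc
      rw [div_mul_cancel₀ _ hc0.ne'] at hFc
      rw [holderFormula, if_neg hqc.not_ge]
      have hc1 : 0 < 1 - c := by linarith [hq.1]
      set m := max (1 - x) 0 / (1 - c) with hm
      have hmc : m * (1 - c) = max (1 - x) 0 := div_mul_cancel₀ _ hc1.ne'
      have hm1 : 1 ≤ x + m * (1 - c) := by
        rw [hmc]
        linarith [le_max_left (1 - x) 0]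
      have hF1 : 0 < y * (x + m * (1 - c)) - 1 := by nlinarith
      -- On `[c, 1]` the opponent's value is affine, so the gap at `1 - q` is a convex combination
      -- of the gaps at `c` and at `1`, where the value is at least `1`.
      have hconv : (1 - c) * (y * (x - m * c + m * (1 - q)) - 1 + (1 + x) / d * q) =
          q * (y * (-1 + (1 + x)) - 1 + (1 + x) / d * (1 - c)) +
            (1 - c - q) * (y * (x + m * (1 - c)) - 1) := by ring
      have hpos : 0 < (1 - c) * (y * (x - m * c + m * (1 - q)) - 1 + (1 + x) / d * q) := by
        rw [hconv]
        exact add_pos_of_nonneg_of_pos (mul_nonneg hq.1 hFc.le)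
          (mul_pos (by linarith) hF1)
      have := (mul_pos_iff_of_pos_left hc1).1 hpos
      linarith
  · intro q hq
    refine (min_le_right _ _).trans ?_
    have hd21 : 0 < 2 * d - 1 := by linarith
    have hopen : -(x / (2 * d - 1)) + 2 * x / (2 * d - 1) * q =
        x - 2 * x / (2 * d - 1) * (d - q) := by
      field_simp
      ring
    have hopen' : 2 * x / (2 * d - 1) * (2 * d - 1) = 2 * x := div_mul_cancel₀ _ hd21.ne'
    rw [hopen]
    rcases le_or_gt (1 - q) c with hqc | hqc
    · rw [holderFormula, if_pos hqc, hline]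
      -- Both slopes compare with `2 * y`: `2 * d - 1 ≥ x / y` and `2 * c ≤ 1 + x`.
      have hslope : 2 * x / (2 * d - 1) ≤ y * (1 + x) / c := by
        rw [div_le_div_iff₀ hd21 hc0]
        rw [div_le_iff₀ (by positivity)] at hdge
        nlinarith
      nlinarith [mul_le_mul_of_nonneg_right hslope (sub_nonneg.2 hq.2)]
    -- An opponent beyond `c` values the cube at `x` or more, so the proposal is worth at most `-(y
    -- * x) < -x`, and the line is at least `-x` on this interval.
    · have h1 := stake_le_holderFormula (x := x) (show 1 - q ≤ 1 by linarith [hq.1]) hqc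
      have h2 : 2 * x / (2 * d - 1) * (d - q) ≤ 2 * x / (2 * d - 1) * (2 * d - 1) :=
        mul_le_mul_of_nonneg_left (by linarith [hq.1]) (by positivity)
      nlinarith

end Reward

/-! ### Backward induction over the proposals left -/

section Value

variable {Ω : Type*} [mΩ : MeasurableSpace Ω] {P : Measure Ω} [IsProbabilityMeasure P]
  {𝓕 : Filtration ℝ≥0 mΩ} {B : ℝ≥0 → Ω → ℝ} {x y : ℝ}

lemma holderValue_eq (hB : IsBrownianMotion P 𝓕 B) (hx : 0 < x) (hxy : x < y) (hy : 1 < y)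
    (k : ℕ) : ∀ p ∈ Icc (0 : ℝ) 1,
      holderValue P 𝓕 B x y k p = holderFormula x (raisePoint x y k) p := by
  induction k with
  | zero =>
    intro p hp
    rw [holderValue, hB.integral_payoff_neverRaise hp, raisePoint_zero hx hxy hy,
      holderFormula_half hx hp.2]
  | succ k ih =>
    intro p hp
    rw [holderValue, ← (isRaiseReward hx hxy hy k).sSup_payoff_eq (tieA := true) hB hp]
    congr! 7 with v τ
    refine hB.integral_payoff_congr hp fun q hq => ?_
    rw [ih (1 - q) ⟨by linarith [hq.2], by linarith [hq.1]⟩]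

lemma expectedPayoff_eq (hB : IsBrownianMotion P 𝓕 B) (hx : 0 < x) (hxy : x < y) (hy : 1 < y)
    (k : ℕ) (tieA : Bool) {p : ℝ} (hp : p ∈ Icc (0 : ℝ) 1) (τ σ : Ω → WithTop ℝ≥0) :
    expectedPayoff P 𝓕 B x y (k + 1) tieA p τ σ = ∫ ω, payoff B
      (fun q => min x (-(y * holderFormula x (raisePoint x y k) (1 - q)))) tieA p τ σ ω ∂P := by
  refine hB.integral_payoff_congr hp fun q hq => ?_
  rw [proposalValue, Nat.add_sub_cancel,
    holderValue_eq hB hx hxy hy k (1 - q) ⟨by linarith [hq.2], by linarith [hq.1]⟩]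

end Value

end RaisingCube

end

theorem theorem1p4 {Ω : Type*} [mΩ : MeasurableSpace Ω] (P : Measure Ω) [IsProbabilityMeasure P]
    (𝓕 : Filtration ℝ≥0 mΩ) (B : ℝ≥0 → Ω → ℝ) (hB : RaisingCube.IsBrownianMotion P 𝓕 B)
    (x y : ℝ) (hx : 0 < x) (hxy : x < y) (hy : 1 < y) (k : ℕ) (hk : 1 ≤ k) :
    -- the optimal state to raise for the player holding the cube is exactly `raisePoint x y k`
    (∀ d : ℝ, RaisingCube.IsOptimalRaisingState P 𝓕 B x y k d ↔
      d = RaisingCube.raisePoint x y k) ∧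
    -- when either player may make the next proposal, it is optimal for both to raise there;
    -- the interval of starting states contains the initial state `1 / 2`
    (1 / 2 < RaisingCube.raisePoint x y k ∧ ∀ tieA : Bool,
      RaisingCube.IsOpeningEquilibrium P 𝓕 B x y k tieA (RaisingCube.raisePoint x y k)) ∧
    -- raising there is strictly better than not raising at all, for the holder of the cube
    (∀ p ∈ Ioc 0 (RaisingCube.raisePoint x y k),
      RaisingCube.expectedPayoff P 𝓕 B x y k true p RaisingCube.neverRaise
          RaisingCube.neverRaise <
        RaisingCube.expectedPayoff P 𝓕 B x y k true p
          (RaisingCube.raiseAt B p (RaisingCube.raisePoint x y k)) RaisingCube.neverRaise) ∧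
    -- and also when either player may make the next proposal
    (∀ tieA : Bool, ∀ p ∈ Ioc (1 - RaisingCube.raisePoint x y k) (RaisingCube.raisePoint x y k),
      RaisingCube.expectedPayoff P 𝓕 B x y k tieA p RaisingCube.neverRaise
          (RaisingCube.raiseAt B p (1 - RaisingCube.raisePoint x y k)) <
        RaisingCube.expectedPayoff P 𝓕 B x y k tieA p
          (RaisingCube.raiseAt B p (RaisingCube.raisePoint x y k))
          (RaisingCube.raiseAt B p (1 - RaisingCube.raisePoint x y k))) := by
  obtain ⟨m, rfl⟩ := Nat.exists_eq_add_of_le' hk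
  have hR := RaisingCube.isRaiseReward hx hxy hy m
  have hE := fun (tieA : Bool) {p : ℝ} (hp : p ∈ Icc (0 : ℝ) 1) =>
    RaisingCube.expectedPayoff_eq hB hx hxy hy m tieA hp
  refine ⟨fun d => ?_, ⟨hR.half_lt, fun tieA p hp ρ hρ => ?_⟩, fun p hp => ?_, fun tieA p hp => ?_⟩
  · rw [← hR.optimal_iff hB d, RaisingCube.IsOptimalRaisingState]
    refine and_congr_right fun hd => forall₂_congr fun p hp => ?_
    simp only [hE true ⟨hp.1, hp.2.trans hd.2⟩]
  · have hp1 := hR.mem_Icc_zero_one hp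
    rw [hE _ hp1, hE _ hp1, hE _ hp1, hR.integral_payoff_open hB hp]
    exact ⟨hR.integral_payoff_le_open hB hp hρ, hR.open_le_integral_payoff hB hp hρ⟩
  · have hp1 : p ∈ Icc (0 : ℝ) 1 := ⟨hp.1.le, hp.2.trans hR.lt_one.le⟩
    rw [hE _ hp1, hE _ hp1, hR.integral_payoff_raiseAt hB ⟨hp.1.le, hp.2⟩,
      hB.integral_payoff_neverRaise hp1]
    linarith [mul_lt_mul_of_pos_right hR.two_lt hp.1]
  · have hp1 := hR.mem_Icc_zero_one ⟨hp.1.le, hp.2⟩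
    rw [hE _ hp1, hE _ hp1]
    exact hR.integral_payoff_neverRaise_lt_open hB hp
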